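/- **Theorem 1 (Large Deviation Principle).** Let $(X,\mathcal A,m)$ be a probability space and let $T:X\to X$ be measurable and non-singular with respect to $m$ (that is, $m(A)=0$ implies $m(T^{-1}A)=0$). Let $P:L^1(m)\to L^1(m)$ be the transfer operator on complex-valued functions: $Pf=\frac{dm_f}{dm}$, where $m_f(A)=\int_{T^{-1}A}f\,dm$. Let $\mathcal B\subset L^1(m)$ be a linear subspace, equipped with its own norm $\|\cdot\|_{\mathcal B}$, such that 1. $(\mathcal B,\|\cdot\|_{\mathcal B})$ is a complex Banach space and the injection $\mathcal B\to L^1(m)$ is continuous; 2. the constant functions lie in $\mathcal B$; 3. there is $C>0$ such that for all $f,g\in\mathcal B$ we have $fg\in\mathcal B$ and $\|fg\|_{\mathcal B}\le C\|f\|_{\mathcal B}\|g\|_{\mathcal B}$; 4. for every $f\in\mathcal B$ we have $\bar f\in\mathcal B$ and $|f|\in\mathcal B$; 5. $P(\mathcal B)\subset\mathcal B$, and $P$ is a bounded operator on $\mathcal B$ with spectral radius equal to $1$; 6. $P$ is quasi-compact of diagonal type on $\mathcal B$: $P=\sum_{i=1}^s\lambda_i\Pi_i+Q$, where $|\lambda_i|=1$,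 the $\Pi_i$ are bounded finite-rank projections on $\mathcal B$ with $\Pi_i\Pi_j=0$ for $i\ne j$, and $Q$ is a bounded operator on $\mathcal B$ with spectral radius strictly less than $1$ and $Q\Pi_i=\Pi_iQ=0$ for all $i$; 7. $1$ is a simple eigenvalue of $P$ on $\mathcal B$, and $P$ has no other eigenvalue of modulus $1$ on $\mathcal B$. Then there is exactly one $T$-invariant probability measure $\mu\ll m$ with $\frac{d\mu}{dm}\in\mathcal B$. Let $\phi:X\to\mathbb R$ be an ($m$-essentially) bounded observable which lies in $\mathcal B$ and satisfies $\int\phi\,d\mu=0$, and put $S_n=\sum_{k=0}^{n-1}\phi\circ T^k$. Then the limit $$\sigma^2=\lim_{n\to\infty}\int\Big(\frac{S_n}{\sqrt n}\Big)^2d\mu$$ exists (and is finite). If $\sigma^2>0$, then there exist $\epsilon_0>0$ and a rate function $c:(-\epsilon_0,\epsilon_0)\to[0,\infty)$, continuous, strictly convex and vanishing only at $0$, such that for every $0<\epsilon<\epsilon_0$ and every probability measure $\nu\ll m$ with $\frac{d\nu}{dm}\in\mathcal B$, $$\lim_{n\to\infty}\frac1n\log\nu(S_n>n\epsilon)=-c(\epsilon).$$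 -/

import Mathlib

open MeasureTheory Filter Topology

noncomputable section

/-- The Perron-Frobenius (transfer) operator of `T` on `L¹(m)`, complex valued: `P f = d m_f / dm`,
the Radon-Nikodym derivative of the complex measure `m_f(A) = ∫_{T⁻¹ A} f dm`, that is, of the
push-forward under `T` of the measure with density `f`. -/
def transfer {X : Type*} [MeasurableSpace X] (m : Measure X) (T : X → X)
    (f : Lp ℂ 1 m) : Lp ℂ 1 m :=
  (ComplexMeasure.integrable_rnDeriv (((m.withDensityᵥ (f : X → ℂ)).map T : ComplexMeasure X))
    m).toL1 _

/-- A complex normed space `B`, realised as a subspace of `L¹(m)` with its own norm through the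
continuous injection `ι`, that contains the constants and is closed under products (with
`‖fg‖ ≤ C ‖f‖ ‖g‖`), complex conjugation and absolute value. -/
structure IsBanachAlgebraLattice {X : Type*} [MeasurableSpace X] {m : Measure X}
    {B : Type*} [NormedAddCommGroup B] [NormedSpace ℂ B] (ι : B →L[ℂ] Lp ℂ 1 m) : Prop where
  injective : Function.Injective ι
  const_mem : ∀ a : ℂ, ∃ h : B, (ι h : X → ℂ) =ᵐ[m] fun _ => a
  mul_mem : ∃ C : ℝ, 0 < C ∧ ∀ f g : B, ∃ h : B,
    ((ι h : X → ℂ) =ᵐ[m] fun x => (ι f : X → ℂ) x * (ι g : X → ℂ) x) ∧ ‖h‖ ≤ C * ‖f‖ * ‖g‖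
  conj_mem : ∀ f : B, ∃ h : B,
    (ι h : X → ℂ) =ᵐ[m] fun x => (starRingEnd ℂ) ((ι f : X → ℂ) x)
  abs_mem : ∀ f : B, ∃ h : B, (ι h : X → ℂ) =ᵐ[m] fun x => ((‖(ι f : X → ℂ) x‖ : ℝ) : ℂ)

/-- Quasi-compactness of diagonal type, with peripheral spectrum on the unit circle:
`P = ∑ λᵢ Πᵢ + Q` with `|λᵢ| = 1`, mutually annihilating finite-rank projections `Πᵢ`, and a
bounded operator `Q` of spectral radius `< 1` with `Q Πᵢ = Πᵢ Q = 0`. -/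
def IsQuasiCompactDiagonal {B : Type*} [NormedAddCommGroup B] [NormedSpace ℂ B]
    (P : B →L[ℂ] B) : Prop :=
  ∃ (s : ℕ) (ev : Fin s → ℂ) (proj : Fin s → (B →L[ℂ] B)) (Q : B →L[ℂ] B),
    P = ∑ i, ev i • proj i + Q ∧
    (∀ i, ‖ev i‖ = 1) ∧
    (∀ i, proj i * proj i = proj i) ∧
    (∀ i, FiniteDimensional ℂ (LinearMap.range (proj i : B →ₗ[ℂ] B))) ∧
    (∀ i j, i ≠ j → proj i * proj j = 0) ∧
    spectralRadius ℂ Q < 1 ∧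
    (∀ i, Q * proj i = 0 ∧ proj i * Q = 0)

/-- `1` is a simple eigenvalue of `P`, and `P` has no other eigenvalue of modulus one. -/
def HasSimplePeripheralEigenvalueOne {B : Type*} [NormedAddCommGroup B] [NormedSpace ℂ B]
    (P : B →L[ℂ] B) : Prop :=
  Module.finrank ℂ (Module.End.eigenspace (P : B →ₗ[ℂ] B) 1) = 1 ∧
  ∀ z : ℂ, ‖z‖ = 1 → Module.End.HasEigenvalue (P : B →ₗ[ℂ] B) z → z = 1

/-- `ν` is a probability measure, absolutely continuous with respect to `m`, whose density
`dν/dm` lies in `B`. -/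
def IsProbWithDensityIn {X : Type*} [MeasurableSpace X] {m : Measure X}
    {B : Type*} [NormedAddCommGroup B] [NormedSpace ℂ B] (ι : B →L[ℂ] Lp ℂ 1 m)
    (ν : Measure X) : Prop :=
  IsProbabilityMeasure ν ∧ ν ≪ m ∧
    ∃ h : B, (ι h : X → ℂ) =ᵐ[m] fun x => (((ν.rnDeriv m x).toReal : ℝ) : ℂ)

/-- `μ` is a `T`-invariant probability measure, absolutely continuous with respect to `m`, with
density in `B`. -/
def IsAcip {X : Type*} [MeasurableSpace X] {m : Measure X} (T : X → X)
    {B : Type*} [NormedAddCommGroup B] [NormedSpace ℂ B] (ι : B →L[ℂ] Lp ℂ 1 m)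
    (μ : Measure X) : Prop :=
  IsProbWithDensityIn ι μ ∧ MeasurePreserving T μ μ

end

/-! The duality `∫ Pf · ψ dm = ∫ f · ψ∘T dm` turns Birkhoff sums into powers of an operator: for the
twisted operator `A z f = P (e^{zφ} f)` one gets `∫ (A z)^n f dm = ∫ f e^{z S_n} dm`
(`integral_twisted_pow`). When `f` is the density of `ν`, this is the moment generating function of
`S_n` under `ν`.

At `z = 0` the peripheral part of `P` is the rank-one projection `f ↦ (∫ f dm) h₀`, where `h₀` is
the invariant density (`IsQuasiCompactDiagonal.exists_rank_one_decomposition`,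
`existsUnique_isAcip`). The eigenvalue `1` continues to a holomorphic `lam z` near `0`, and `∫ (A
z)^n f dm / lam z ^ n` is bounded uniformly and converges (`exists_perturbed_eigenvalue`).

Everything is then read off `L = log lam`. Since `E_μ[e^{z S_n}] e^{-n L(z)}` is bounded near `0`
uniformly in `n`, Cauchy's estimates of order one and two give `L'(0) = 0` and `E_μ[S_n²] = n L''(0)
+ O(1)`, so `σ² = Re L''(0)` (`tendsto_second_moment_of_complexMGF_le`).

If `σ² > 0`, then `Re L` is strictly convex on a real interval around `0`, and there it is the
exponential growth rate of the moment generating functions under every admissible `ν`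
(`tendsto_log_integral_exp_birkhoffSum`). A local Gärtner-Ellis argument (`tendsto_log_measure_gt`)
gives the large deviation limit, and the rate function is the local Legendre transform of `Re L`
(`exists_rate_function`), hence the same for all `ν`. -/

/-! ### Duality for the transfer operator -/

/-- The transfer operator is characterised by `∫_A P f dm = ∫_{T⁻¹ A} f dm`. -/
theorem setIntegral_transfer {X : Type*} [MeasurableSpace X] {m : Measure X} [IsProbabilityMeasure m]
    {T : X → X} (hT : Measure.QuasiMeasurePreserving T m m) (f : Lp ℂ 1 m) {A : Set X}
    (hA : MeasurableSet A) :
    ∫ x in A, (transfer m T f : X → ℂ) x ∂m = ∫ x in T ⁻¹' A, (f : X → ℂ) x ∂m := by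
  have hf : Integrable (f : X → ℂ) m := L1.integrable_coeFn f
  set c : ComplexMeasure X := (m.withDensityᵥ (f : X → ℂ)).map T with hc
  have hcA : ∀ {s : Set X}, MeasurableSet s → c s = ∫ x in T ⁻¹' s, (f : X → ℂ) x ∂m := by
    intro s hs
    rw [hc, VectorMeasure.map_apply _ hT.measurable hs,
      withDensityᵥ_apply hf (hT.measurable hs)]
  have hac : ∀ s : Set X, MeasurableSet s → m s = 0 → c s = 0 := by
    intro s hs h0
    rw [hcA hs, setIntegral_measure_zero]
    exact hT.preimage_null h0
  have hre : m.withDensityᵥ (c.re.rnDeriv m) = c.re := by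
    rw [← SignedMeasure.absolutelyContinuous_iff_withDensityᵥ_rnDeriv_eq]
    refine VectorMeasure.AbsolutelyContinuous.mk fun s hs h0 => ?_
    rw [Measure.toENNRealVectorMeasure_apply_measurable hs] at h0
    change (c s).re = 0
    rw [hac s hs h0, Complex.zero_re]
  have him : m.withDensityᵥ (c.im.rnDeriv m) = c.im := by
    rw [← SignedMeasure.absolutelyContinuous_iff_withDensityᵥ_rnDeriv_eq]
    refine VectorMeasure.AbsolutelyContinuous.mk fun s hs h0 => ?_
    rw [Measure.toENNRealVectorMeasure_apply_measurable hs] at h0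
    change (c s).im = 0
    rw [hac s hs h0, Complex.zero_im]
  have hint := ComplexMeasure.integrable_rnDeriv c m
  have h1 : ∫ x in A, (transfer m T f : X → ℂ) x ∂m = ∫ x in A, c.rnDeriv m x ∂m :=
    integral_congr_ae (ae_restrict_of_ae (Integrable.coeFn_toL1 hint))
  rw [h1, ← hcA hA]
  apply Complex.ext
  · rw [← RCLike.re_eq_complex_re, ← integral_re hint.integrableOn]
    have := congrArg (fun v => v A) hre
    simp only [withDensityᵥ_apply (SignedMeasure.integrable_rnDeriv c.re m) hA] at this
    exact this
  · rw [← RCLike.im_eq_complex_im, ← integral_im hint.integrableOn]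
    have := congrArg (fun v => v A) him
    simp only [withDensityᵥ_apply (SignedMeasure.integrable_rnDeriv c.im m) hA] at this
    exact this

/-- Duality between the transfer operator and composition with `T`, for bounded test functions. -/
theorem integral_transfer_mul {X : Type*} [MeasurableSpace X] {m : Measure X}
    [IsProbabilityMeasure m] {T : X → X} (hT : Measure.QuasiMeasurePreserving T m m)
    (f : Lp ℂ 1 m) {ψ : X → ℂ} (hψ : AEStronglyMeasurable ψ m) {K : ℝ}
    (hK : ∀ᵐ x ∂m, ‖ψ x‖ ≤ K) :
    ∫ x, (transfer m T f : X → ℂ) x * ψ x ∂m = ∫ x, (f : X → ℂ) x * ψ (T x) ∂m := by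
  have hf : Integrable (f : X → ℂ) m := L1.integrable_coeFn f
  have hg : Integrable (transfer m T f : X → ℂ) m := L1.integrable_coeFn _
  have hsimple : ∀ s : SimpleFunc X ℂ,
      ∫ x, (transfer m T f : X → ℂ) x * s x ∂m = ∫ x, (f : X → ℂ) x * s (T x) ∂m := by
    intro s
    induction s using SimpleFunc.induction with
    | const c hs =>
      rename_i s
      have e1 : ∀ x, (transfer m T f : X → ℂ) x * (SimpleFunc.piecewise s hs
          (SimpleFunc.const X c) (SimpleFunc.const X 0)) x
          = s.indicator (fun x => (transfer m T f : X → ℂ) x * c) x := by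
        intro x
        by_cases hx : x ∈ s <;> simp [hx]
      have e2 : ∀ x, (f : X → ℂ) x * (SimpleFunc.piecewise s hs
          (SimpleFunc.const X c) (SimpleFunc.const X 0)) (T x)
          = (T ⁻¹' s).indicator (fun x => (f : X → ℂ) x * c) x := by
        intro x
        by_cases hx : T x ∈ s <;> simp [hx]
      simp_rw [e1, e2]
      rw [integral_indicator hs, integral_indicator (hT.measurable hs), integral_mul_const,
        integral_mul_const, setIntegral_transfer hT f hs]
    | @add s t _ h1 h2 =>
      obtain ⟨Cs, hCs⟩ := s.exists_forall_norm_le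
      obtain ⟨Ct, hCt⟩ := t.exists_forall_norm_le
      simp only [SimpleFunc.coe_add, Pi.add_apply, mul_add]
      rw [integral_add, integral_add, h1, h2]
      · exact hf.mul_bdd (s.measurable.comp hT.measurable).aestronglyMeasurable
          (Eventually.of_forall fun x => hCs _)
      · exact hf.mul_bdd (t.measurable.comp hT.measurable).aestronglyMeasurable
          (Eventually.of_forall fun x => hCt _)
      · exact hg.mul_bdd s.aestronglyMeasurable (Eventually.of_forall fun x => hCs _)
      · exact hg.mul_bdd t.aestronglyMeasurable (Eventually.of_forall fun x => hCt _)
  have hstrong : ∀ ψ : X → ℂ, StronglyMeasurable ψ → (∀ᵐ x ∂m, ‖ψ x‖ ≤ K) →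
      ∫ x, (transfer m T f : X → ℂ) x * ψ x ∂m = ∫ x, (f : X → ℂ) x * ψ (T x) ∂m := by
    intro ψ hψ hK
    -- The truncated simple approximations need a nonnegative bound, hence `max K 0`.
    have hK' : ∀ᵐ x ∂m, ‖ψ x‖ ≤ max K 0 := hK.mono fun x hx => hx.trans (le_max_left _ _)
    have hlim := hψ.tendsto_approxBounded_ae hK'
    have hlimT := hT.ae hlim
    have hbd := hψ.norm_approxBounded_le (c := max K 0) (le_max_right _ _)
    refine tendsto_nhds_unique (f := fun n => ∫ x, (transfer m T f : X → ℂ) x *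
        hψ.approxBounded (max K 0) n x ∂m) (l := atTop) ?_ ?_
    · refine tendsto_integral_of_dominated_convergence
        (fun x => ‖(transfer m T f : X → ℂ) x‖ * max K 0) ?_ (hg.norm.mul_const _) ?_ ?_
      · exact fun n => hg.aestronglyMeasurable.mul (SimpleFunc.aestronglyMeasurable _)
      · intro n
        refine Eventually.of_forall fun x => ?_
        rw [norm_mul]
        exact mul_le_mul_of_nonneg_left (hbd n x) (norm_nonneg _)
      · filter_upwards [hlim] with x hx using hx.const_mul _
    · simp_rw [hsimple]
      refine tendsto_integral_of_dominated_convergence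
        (fun x => ‖(f : X → ℂ) x‖ * max K 0) ?_ (hf.norm.mul_const _) ?_ ?_
      · exact fun n => hf.aestronglyMeasurable.mul
          ((SimpleFunc.measurable _).comp hT.measurable).aestronglyMeasurable
      · intro n
        refine Eventually.of_forall fun x => ?_
        rw [norm_mul]
        exact mul_le_mul_of_nonneg_left (hbd n _) (norm_nonneg _)
      · filter_upwards [hlimT] with x hx using hx.const_mul _
  have hae := hψ.ae_eq_mk
  have haeT := hT.ae hae
  have key := hstrong (hψ.mk ψ) hψ.stronglyMeasurable_mk (by
    filter_upwards [hae, hK] with x hx hx'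
    rwa [← hx])
  rw [integral_congr_ae (g := fun x => (transfer m T f : X → ℂ) x * hψ.mk ψ x), key]
  · refine integral_congr_ae ?_
    filter_upwards [haeT] with x hx
    rw [hx]
  · filter_upwards [hae] with x hx
    rw [hx]

/-! ### Powers of an element of spectral radius less than one -/

/-- Each block of `N` consecutive powers is at most `q` times the preceding one, so the sum is
dominated by a geometric series of blocks. The bound depends only on `N`, `q`, `D`, and strict forms
of the hypotheses involve finitely many powers and are open in `a`: this yields uniformity under
perturbation. -/
theorem sum_norm_pow_le {𝓐 : Type*} [NormedRing 𝓐] {a : 𝓐} {N : ℕ} (hN : 0 < N) {q D : ℝ}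
    (hq0 : 0 ≤ q) (hq1 : q < 1) (hq : ‖a ^ N‖ ≤ q) (hD : ∀ j < N, ‖a ^ j‖ ≤ D) (n : ℕ) :
    ∑ k ∈ Finset.range n, ‖a ^ k‖ ≤ N * D / (1 - q) := by
  have hD0 : 0 ≤ D := (norm_nonneg _).trans (hD 0 hN)
  have hq' : 0 < 1 - q := by linarith
  have hbase : ∀ n ≤ N, ∑ k ∈ Finset.range n, ‖a ^ k‖ ≤ N * D := by
    intro n hn
    calc ∑ k ∈ Finset.range n, ‖a ^ k‖ ≤ ∑ k ∈ Finset.range n, D :=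
          Finset.sum_le_sum fun k hk => hD k (lt_of_lt_of_le (Finset.mem_range.1 hk) hn)
      _ = n * D := by simp
      _ ≤ N * D := by gcongr
  induction n using Nat.strong_induction_on with
  | _ n ih =>
    rcases le_total n N with hn | hn
    · refine (hbase n hn).trans ?_
      rw [le_div_iff₀ hq']
      nlinarith [mul_nonneg (Nat.cast_nonneg (α := ℝ) N) hD0]
    · obtain ⟨k, rfl⟩ := Nat.exists_eq_add_of_le hn
      rw [Finset.sum_range_add]
      have h1 : ∑ x ∈ Finset.range k, ‖a ^ (N + x)‖ ≤ q * ∑ x ∈ Finset.range k, ‖a ^ x‖ := by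
        rw [Finset.mul_sum]
        refine Finset.sum_le_sum fun x _ => ?_
        rw [pow_add]
        exact (norm_mul_le _ _).trans (by gcongr)
      have h2 := ih k (by omega)
      have h3 : q * ∑ x ∈ Finset.range k, ‖a ^ x‖ ≤ q * (N * D / (1 - q)) := by gcongr
      have h4 : (N : ℝ) * D + q * (N * D / (1 - q)) = N * D / (1 - q) := by
        field_simp
        ring
      linarith [hbase N le_rfl]

theorem exists_norm_pow_lt_one {𝓐 : Type*} [NormedRing 𝓐] [NormedAlgebra ℂ 𝓐] [CompleteSpace 𝓐]
    {a : 𝓐} (ha : spectralRadius ℂ a < 1) : ∃ N, 0 < N ∧ ‖a ^ N‖ < 1 := by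
  have h := (spectrum.pow_nnnorm_pow_one_div_tendsto_nhds_spectralRadius a).eventually_lt_const ha
  obtain ⟨N, hN, hN0⟩ := (h.and (eventually_gt_atTop 0)).exists
  refine ⟨N, hN0, ?_⟩
  by_contra hcon
  push Not at hcon
  refine absurd hN (not_lt.2 ?_)
  refine ENNReal.one_le_rpow ?_ (by positivity)
  exact_mod_cast hcon

theorem tendsto_pow_zero_of_spectralRadius_lt_one {𝓐 : Type*} [NormedRing 𝓐] [NormedAlgebra ℂ 𝓐]
    [CompleteSpace 𝓐] {a : 𝓐} (ha : spectralRadius ℂ a < 1) :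
    Tendsto (fun n => a ^ n) atTop (𝓝 0) := by
  obtain ⟨N, hN, hlt⟩ := exists_norm_pow_lt_one ha
  have hs : Summable fun n => ‖a ^ n‖ := by
    refine summable_of_sum_range_le (fun n => norm_nonneg _)
      (sum_norm_pow_le hN (norm_nonneg _) hlt le_rfl (D := ∑ j ∈ Finset.range N, ‖a ^ j‖) ?_)
    intro j hj
    exact Finset.single_le_sum (f := fun j => ‖a ^ j‖) (fun _ _ => norm_nonneg _)
      (Finset.mem_range.2 hj)
  exact tendsto_zero_iff_norm_tendsto_zero.2 hs.tendsto_atTop_zero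

/-! ### Perturbation of the leading eigenvalue -/

/-- Iterates of an operator `A` with eigenvector `h`, `A h = lam h`, in terms of the powers of
`R f = lam⁻¹ (A f - mi (A f) h)`. -/
theorem pow_apply_eq_of_eigenvector {B : Type*} [NormedAddCommGroup B] [NormedSpace ℂ B]
    {A R : B →L[ℂ] B} {mi : B →L[ℂ] ℂ} {h : B} {lam : ℂ} (hlam : lam ≠ 0) (hh : A h = lam • h)
    (hR : ∀ f, R f = lam⁻¹ • (A f - mi (A f) • h)) (n : ℕ) (f : B) :
    (A ^ n) f = lam ^ n • ((R ^ n) f + (lam⁻¹ * ∑ k ∈ Finset.range n, mi (A ((R ^ k) f))) • h) := by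
  induction n with
  | zero => simp
  | succ n ih =>
    have hA : A ((R ^ n) f) = lam • R ((R ^ n) f) + mi (A ((R ^ n) f)) • h := by
      rw [hR, smul_smul, mul_inv_cancel₀ hlam, one_smul, sub_add_cancel]
    rw [pow_succ', mul_apply_eq_comp, ih, map_smul, map_add, map_smul, hh, hA,
      pow_succ' R, mul_apply_eq_comp, Finset.sum_range_succ]
    simp only [smul_add, smul_smul, add_assoc, ← add_smul]
    congr 2
    field_simp
    ring

/-- Perturbation of a simple isolated dominating eigenvalue along a `C¹` family of operators. -/
theorem exists_perturbed_eigenvalue {B : Type*} [NormedAddCommGroup B] [NormedSpace ℂ B]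
    [CompleteSpace B] {A : ℂ → B →L[ℂ] B} (hA : ContDiff ℂ 1 A) {mi : B →L[ℂ] ℂ} {h₀ : B}
    {Q : B →L[ℂ] B} (hA0 : ∀ f, A 0 f = mi f • h₀ + Q f) (h1 : mi h₀ = 1) (hQ0 : Q h₀ = 0)
    (hmQ : ∀ f, mi (Q f) = 0) (hQ : spectralRadius ℂ Q < 1) :
    ∃ (r : ℝ) (lam : ℂ → ℂ) (C : ℝ), 0 < r ∧ DifferentiableOn ℂ lam (Metric.ball 0 r) ∧
      lam 0 = 1 ∧ ∀ z ∈ Metric.ball (0 : ℂ) r, ‖lam z - 1‖ < 1 / 2 ∧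
        (∀ n f, ‖mi ((A z ^ n) f)‖ ≤ C * ‖lam z‖ ^ n * ‖f‖) ∧
        ∃ ℓ : B → ℂ, (∀ f, Tendsto (fun n => mi ((A z ^ n) f) / lam z ^ n) atTop (𝓝 (ℓ f))) ∧
          ‖ℓ h₀ - 1‖ ≤ 1 / 2 := by
  classical
  -- the eigenvector, by the implicit function theorem
  set F : ℂ × B → B := fun u => A u.1 u.2 - mi (A u.1 u.2) • u.2 with hF
  have hFsmooth : ContDiffAt ℂ 1 F (0, h₀) := by
    have hAp : ContDiff ℂ 1 fun u : ℂ × B => A u.1 u.2 :=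
      (hA.comp contDiff_fst).clm_apply contDiff_snd
    exact (hAp.sub ((mi.contDiff.comp hAp).smul contDiff_snd)).contDiffAt
  have hF0 : F (0, h₀) = 0 := by simp [hF, hA0, h1, hQ0]
  have hunit : IsUnit (Q - 1) := by
    have := spectrum.mem_resolventSet_of_spectralRadius_lt (a := Q) (k := (1 : ℂ)) (by simpa using hQ)
    rw [spectrum.mem_resolventSet_iff, map_one] at this
    rw [← neg_sub]
    exact this.neg
  -- In the direction `f` the derivative is `A 0 f - mi (A 0 f) • h₀ - mi (A 0 h₀) • f`; the two
  -- multiples of `h₀` cancel and `mi (A 0 h₀) = 1`. The result `Q - 1` is invertible because `1`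
  -- lies outside the spectrum of `Q`.
  have hderiv : fderiv ℂ F (0, h₀) ∘L .inr ℂ ℂ B = Q - 1 := by
    have hd1 : HasFDerivAt (fun h => F (0, h)) (fderiv ℂ F (0, h₀) ∘L .inr ℂ ℂ B) h₀ := by
      have hdF : HasFDerivAt F (fderiv ℂ F (0, h₀)) (0, h₀) :=
        (hFsmooth.differentiableAt (by simp)).hasFDerivAt
      exact HasFDerivAt.comp h₀ hdF (hasFDerivAt_prodMk_right (0 : ℂ) h₀)
    have hd2 := ((A 0).hasFDerivAt (x := h₀)).sub
      (((mi ∘L A 0).hasFDerivAt (x := h₀)).smul (hasFDerivAt_id (𝕜 := ℂ) h₀))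
    have := hd1.unique hd2
    rw [this]
    ext f
    simp [hA0, h1, hQ0, hmQ]
    abel
  have hinv : (fderiv ℂ F (0, h₀) ∘L .inr ℂ ℂ B).IsInvertible := by
    rw [hderiv]
    obtain ⟨u, hu⟩ := hunit
    exact ⟨ContinuousLinearEquiv.unitsEquiv ℂ B u, by rw [← hu]; rfl⟩
  set h : ℂ → B := hFsmooth.implicitFunction one_ne_zero hinv with hh
  have h_zero : h 0 = h₀ := hFsmooth.implicitFunction_apply_self one_ne_zero hinv
  have h_eq : ∀ᶠ z in 𝓝 (0 : ℂ), F (z, h z) = 0 := by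
    have := hFsmooth.eventually_apply_implicitFunction one_ne_zero hinv
    rwa [hF0] at this
  have h_smooth : ContDiffAt ℂ 1 h 0 := hFsmooth.contDiffAt_implicitFunction one_ne_zero hinv
  -- the eigenvalue
  set lam : ℂ → ℂ := fun z => mi (A z (h z)) with hlam
  have lam_smooth : ContDiffAt ℂ 1 lam 0 :=
    (mi.contDiff.contDiffAt).comp 0 (hA.contDiffAt.clm_apply h_smooth)
  have lam_zero : lam 0 = 1 := by simp [hlam, h_zero, hA0, h1, hQ0]
  have lam_diff : ∀ᶠ z in 𝓝 (0 : ℂ), DifferentiableAt ℂ lam z :=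
    (lam_smooth.eventually (by simp)).mono fun z hz => hz.differentiableAt (by simp)
  -- the complementary part
  set R : ℂ → B →L[ℂ] B := fun z => (lam z)⁻¹ • (A z - (mi ∘L A z).smulRight (h z)) with hR
  have R_zero : R 0 = Q := by
    ext f
    simp [hR, lam_zero, hA0, h_zero, h1, hmQ]
  have R_cont : ContinuousAt R 0 := by
    have hc : ContDiffAt ℂ 1 (fun z => (mi ∘L A z).smulRight (h z)) 0 :=
      (contDiffAt_const.clm_comp hA.contDiffAt).smulRight h_smooth
    exact (lam_smooth.continuousAt.inv₀ (by simp [lam_zero])).smul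
      (hA.continuous.continuousAt.sub hc.continuousAt)
  obtain ⟨N, hN, hlt⟩ := exists_norm_pow_lt_one hQ
  obtain ⟨q, hq, hq1⟩ := exists_between hlt
  have hq0 : 0 ≤ q := (norm_nonneg _).trans hq.le
  -- The extra `1` makes the bounds on `‖Q ^ j‖` strict, so that they persist for `R z` near `0`.
  set D : ℝ := 1 + ∑ j ∈ Finset.range N, ‖Q ^ j‖ with hD
  have ev1 : ∀ᶠ z in 𝓝 (0 : ℂ), ‖R z ^ N‖ < q := by
    have : ContinuousAt (fun z => ‖R z ^ N‖) 0 := (R_cont.pow N).norm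
    exact this.eventually_lt_const (by simpa only [R_zero] using hq)
  have ev2 : ∀ᶠ z in 𝓝 (0 : ℂ), ∀ j ∈ Finset.range N, ‖R z ^ j‖ < D := by
    rw [Filter.eventually_all_finset]
    intro j hj
    have : ContinuousAt (fun z => ‖R z ^ j‖) 0 := (R_cont.pow j).norm
    refine this.eventually_lt_const ?_
    simp only [R_zero]
    have : ‖Q ^ j‖ ≤ ∑ j ∈ Finset.range N, ‖Q ^ j‖ :=
      Finset.single_le_sum (f := fun j => ‖Q ^ j‖) (fun _ _ => norm_nonneg _) hj
    linarith
  have ev3 : ∀ᶠ z in 𝓝 (0 : ℂ), ‖A z‖ < ‖A 0‖ + 1 :=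
    hA.continuous.continuousAt.norm.eventually_lt_const (by simp)
  have ev4 : ∀ᶠ z in 𝓝 (0 : ℂ), ‖lam z - 1‖ < 1 / 2 := by
    have : ContinuousAt (fun z => ‖lam z - 1‖) 0 :=
      (lam_smooth.continuousAt.sub continuousAt_const).norm
    exact this.eventually_lt_const (by simp [lam_zero])
  set S : ℝ := N * D / (1 - q) with hS
  have hS0 : 0 ≤ S := by
    have : 0 ≤ D := by positivity
    have : 0 < 1 - q := by linarith
    positivity
  -- The first summand bounds `mi ((R z ^ n) f)`, the second the sum over `k` in `hquot`; the factor
  -- `2` bounds `‖(lam z)⁻¹‖`.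
  set C : ℝ := ‖mi‖ * S + 2 * (‖mi‖ * ((‖A 0‖ + 1) * S)) with hC
  have hC0 : 0 ≤ C := by positivity
  have ev5 : ∀ᶠ z in 𝓝 (0 : ℂ), C * ‖h₀ - h z‖ < 1 / 2 := by
    have : ContinuousAt (fun z => C * ‖h₀ - h z‖) 0 :=
      continuousAt_const.mul (continuousAt_const.sub h_smooth.continuousAt).norm
    exact this.eventually_lt_const (by simp [h_zero])
  obtain ⟨r, hr, hball⟩ := Metric.eventually_nhds_iff_ball.1
    (h_eq.and (lam_diff.and (ev1.and (ev2.and (ev3.and (ev4.and ev5))))))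
  refine ⟨r, lam, C, hr, fun z hz => (hball z hz).2.1.differentiableWithinAt, lam_zero, ?_⟩
  intro z hz
  obtain ⟨hFz, -, hz1, hz2, hz3, hz4, hz5⟩ := hball z hz
  have hlam2 : (1 : ℝ) / 2 ≤ ‖lam z‖ := by
    have := norm_sub_norm_le (1 : ℂ) (1 - lam z)
    rw [norm_one, sub_sub_cancel, norm_sub_rev] at this
    linarith
  have hlam0 : lam z ≠ 0 := by
    intro h0
    rw [h0, norm_zero] at hlam2
    linarith
  have hlaminv : ‖(lam z)⁻¹‖ ≤ 2 := by
    rw [norm_inv]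
    exact inv_le_of_inv_le₀ (by norm_num) (by linarith)
  have heig : A z (h z) = lam z • h z := sub_eq_zero.1 hFz
  -- The equation `F = 0` carries its own normalisation: applying `mi` gives `lam z = lam z * mi (h
  -- z)`.
  have hmih : mi (h z) = 1 := by
    have := congrArg mi heig
    rw [map_smul, smul_eq_mul] at this
    exact mul_left_cancel₀ hlam0 (by rw [← this, mul_one])
  have hRf : ∀ f, R z f = (lam z)⁻¹ • (A z f - mi (A z f) • h z) := fun f => by simp [hR]
  have hsum := sum_norm_pow_le hN hq0 hq1 hz1.le (fun j hj => (hz2 j (Finset.mem_range.2 hj)).le)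
  have hsummable : Summable fun n => ‖R z ^ n‖ :=
    summable_of_sum_range_le (fun n => norm_nonneg _) hsum
  have hquot : ∀ n f, mi ((A z ^ n) f) / lam z ^ n = mi ((R z ^ n) f) +
      (lam z)⁻¹ * ∑ k ∈ Finset.range n, mi (A z ((R z ^ k) f)) := by
    intro n f
    rw [pow_apply_eq_of_eigenvector hlam0 heig hRf, map_smul, map_add, map_smul, hmih, smul_eq_mul,
      smul_eq_mul, mul_one, mul_div_cancel_left₀ _ (pow_ne_zero _ hlam0)]
  have hterm : ∀ k f, ‖mi (A z ((R z ^ k) f))‖ ≤ ‖mi‖ * ((‖A 0‖ + 1) * ‖R z ^ k‖) * ‖f‖ := by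
    intro k f
    calc ‖mi (A z ((R z ^ k) f))‖ ≤ ‖mi‖ * (‖A z‖ * (‖R z ^ k‖ * ‖f‖)) :=
          (mi.le_opNorm _).trans (by
            gcongr
            exact ((A z).le_opNorm _).trans (by gcongr; exact (R z ^ k).le_opNorm _))
      _ ≤ ‖mi‖ * ((‖A 0‖ + 1) * (‖R z ^ k‖ * ‖f‖)) := by gcongr
      _ = _ := by ring
  have hquot_le : ∀ n f, ‖mi ((A z ^ n) f) / lam z ^ n‖ ≤ C * ‖f‖ := by
    intro n f
    rw [hquot]
    have e1 : ‖mi ((R z ^ n) f)‖ ≤ ‖mi‖ * S * ‖f‖ := by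
      refine (mi.le_opNorm _).trans ?_
      rw [mul_assoc]
      gcongr
      refine ((R z ^ n).le_opNorm _).trans ?_
      gcongr
      exact (Finset.single_le_sum (f := fun j => ‖R z ^ j‖) (fun _ _ => norm_nonneg _)
        (Finset.self_mem_range_succ n)).trans (hsum (n + 1))
    have e2 : ‖∑ k ∈ Finset.range n, mi (A z ((R z ^ k) f))‖ ≤
        ‖mi‖ * ((‖A 0‖ + 1) * S) * ‖f‖ := by
      refine (norm_sum_le_of_le _ fun k _ => hterm k f).trans ?_
      rw [← Finset.sum_mul, ← Finset.mul_sum, ← Finset.mul_sum]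
      gcongr
      exact hsum n
    calc _ ≤ ‖mi ((R z ^ n) f)‖ + ‖(lam z)⁻¹‖ * ‖∑ k ∈ Finset.range n, mi (A z ((R z ^ k) f))‖ := by
          rw [← norm_mul]
          exact norm_add_le _ _
      _ ≤ ‖mi‖ * S * ‖f‖ + 2 * (‖mi‖ * ((‖A 0‖ + 1) * S) * ‖f‖) := by gcongr
      _ = C * ‖f‖ := by rw [hC]; ring
  refine ⟨hz4, ?_, ?_⟩
  · intro n f
    have := hquot_le n f
    rw [norm_div, norm_pow, div_le_iff₀ (by positivity)] at this
    linarith [this]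
  · have hlim : ∀ f, Tendsto (fun n => mi ((A z ^ n) f) / lam z ^ n) atTop
        (𝓝 ((lam z)⁻¹ * ∑' k, mi (A z ((R z ^ k) f)))) := by
      intro f
      simp_rw [hquot]
      have s1 : Summable fun k => mi (A z ((R z ^ k) f)) :=
        Summable.of_norm_bounded (((hsummable.mul_left _).mul_left _).mul_right _)
          (fun k => hterm k f)
      have s2 : Tendsto (fun n => R z ^ n) atTop (𝓝 0) :=
        tendsto_zero_iff_norm_tendsto_zero.2 hsummable.tendsto_atTop_zero
      have s3 : Tendsto (fun n => mi ((R z ^ n) f)) atTop (𝓝 0) := by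
        have := (mi.continuous.tendsto _).comp
          (((ContinuousLinearMap.apply ℂ B f).continuous.tendsto _).comp s2)
        simpa only [Function.comp_def, ContinuousLinearMap.apply_apply,
          zero_apply, map_zero] using this
      simpa using s3.add (s1.hasSum.tendsto_sum_nat.const_mul (lam z)⁻¹)
    refine ⟨_, hlim, ?_⟩
    have hpow : ∀ n, (A z ^ n) (h z) = lam z ^ n • h z := by
      intro n
      induction n with
      | zero => simp
      | succ n ih =>
        rw [pow_succ', mul_apply_eq_comp, ih, map_smul, heig, smul_smul, pow_succ]
    -- On the eigenvector `h z` the quotients are identically `1`, so the limit at `h₀` minus `1` is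
    -- the limit at `h₀ - h z`, which the uniform bound and `ev5` make small.
    have hdiff : Tendsto (fun n => mi ((A z ^ n) (h₀ - h z)) / lam z ^ n) atTop
        (𝓝 ((lam z)⁻¹ * ∑' k, mi (A z ((R z ^ k) h₀)) - 1)) := by
      refine ((hlim h₀).sub_const 1).congr fun n => ?_
      rw [map_sub, map_sub, hpow, map_smul, hmih, smul_eq_mul, mul_one, sub_div,
        div_self (pow_ne_zero _ hlam0)]
    exact le_of_tendsto hdiff.norm (Eventually.of_forall fun n => (hquot_le n _).trans hz5.le)

/-! ### Convexity and the local Legendre transform -/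

/-- A strictly convex differentiable function lies strictly above its tangent lines. -/
theorem tangent_lt_of_strictMonoOn {Λ ψ : ℝ → ℝ} {a : ℝ}
    (hd : ∀ θ ∈ Set.Ioo (-a) a, HasDerivAt Λ (ψ θ) θ) (hmono : StrictMonoOn ψ (Set.Ioo (-a) a))
    {t θ : ℝ} (ht : t ∈ Set.Ioo (-a) a) (hθ : θ ∈ Set.Ioo (-a) a) (hne : θ ≠ t) :
    Λ t + ψ t * (θ - t) < Λ θ := by
  rcases lt_or_gt_of_ne hne with h | h
  · have hsub : Set.Icc θ t ⊆ Set.Ioo (-a) a := Set.Icc_subset_Ioo hθ.1 ht.2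
    obtain ⟨ξ, hξ, he⟩ := exists_hasDerivAt_eq_slope Λ ψ h
      (fun x hx => (hd x (hsub hx)).continuousAt.continuousWithinAt)
      (fun x hx => hd x (hsub (Set.Ioo_subset_Icc_self hx)))
    have hlt := hmono (hsub (Set.Ioo_subset_Icc_self hξ)) ht hξ.2
    rw [eq_div_iff (by linarith)] at he
    nlinarith
  · have hsub : Set.Icc t θ ⊆ Set.Ioo (-a) a := Set.Icc_subset_Ioo ht.1 hθ.2
    obtain ⟨ξ, hξ, he⟩ := exists_hasDerivAt_eq_slope Λ ψ h
      (fun x hx => (hd x (hsub hx)).continuousAt.continuousWithinAt)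
      (fun x hx => hd x (hsub (Set.Ioo_subset_Icc_self hx)))
    have hlt := hmono ht (hsub (Set.Ioo_subset_Icc_self hξ)) hξ.1
    rw [eq_div_iff (by linarith)] at he
    nlinarith

/-- The local Legendre transform of `Λ` at `0`, with `ψ = Λ'`, is a rate function. -/
theorem exists_rate_function {Λ ψ : ℝ → ℝ} {a : ℝ} (ha : 0 < a) (hΛ0 : Λ 0 = 0) (hψ0 : ψ 0 = 0)
    (hψc : ContinuousOn ψ (Set.Ioo (-a) a)) (hmono : StrictMonoOn ψ (Set.Ioo (-a) a))
    (htan : ∀ t ∈ Set.Ioo (-a) a, ∀ θ ∈ Set.Ioo (-a) a, θ ≠ t → Λ t + ψ t * (θ - t) < Λ θ) :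
    ∃ ε₀ : ℝ, 0 < ε₀ ∧ ∃ c : ℝ → ℝ,
      ContinuousOn c (Set.Ioo (-ε₀) ε₀) ∧
      StrictConvexOn ℝ (Set.Ioo (-ε₀) ε₀) c ∧
      (∀ ε ∈ Set.Ioo (-ε₀) ε₀, 0 ≤ c ε) ∧
      (∀ ε ∈ Set.Ioo (-ε₀) ε₀, c ε = 0 ↔ ε = 0) ∧
      ∀ ε : ℝ, 0 < ε → ε < ε₀ → ∃ t ∈ Set.Ioo 0 a, ψ t = ε ∧ -c ε = Λ t - t * ε := by
  have h0 : (0 : ℝ) ∈ Set.Ioo (-a) a := ⟨by linarith, ha⟩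
  have hp : a / 2 ∈ Set.Ioo (-a) a := ⟨by linarith, by linarith⟩
  have hm : -(a / 2) ∈ Set.Ioo (-a) a := ⟨by linarith, by linarith⟩
  have hψp : 0 < ψ (a / 2) := hψ0 ▸ hmono h0 hp (by linarith)
  have hψm : ψ (-(a / 2)) < 0 := hψ0 ▸ hmono hm h0 (by linarith)
  -- Chosen so that `(-ε₀, ε₀)` lies in the image of `[-a/2, a/2]` under `ψ`, by the intermediate
  -- value theorem.
  set ε₀ := min (ψ (a / 2)) (-ψ (-(a / 2))) with hε₀
  have hε₀pos : 0 < ε₀ := lt_min hψp (by linarith)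
  have hsurj : ∀ ε ∈ Set.Ioo (-ε₀) ε₀, ∃ t ∈ Set.Ioo (-a) a, ψ t = ε := by
    intro ε hε
    have hsub : Set.Icc (-(a / 2)) (a / 2) ⊆ Set.Ioo (-a) a := Set.Icc_subset_Ioo hm.1 hp.2
    obtain ⟨t, ht, hte⟩ := intermediate_value_Icc (by linarith) (hψc.mono hsub)
      (show ε ∈ Set.Icc (ψ (-(a / 2))) (ψ (a / 2)) from
        ⟨by linarith [hε.1, min_le_right (ψ (a / 2)) (-ψ (-(a / 2)))],
          hε.2.le.trans (min_le_left _ _)⟩)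
    exact ⟨t, hsub ht, hte⟩
  choose! τ hτ hψτ using hsurj
  set c : ℝ → ℝ := fun ε => τ ε * ε - Λ (τ ε) with hc
  -- By the strict tangent inequality, `θ * ε - Λ θ` has its unique maximum at `τ ε`, where `Λ` has
  -- slope `ε`.
  have hlt : ∀ ε ∈ Set.Ioo (-ε₀) ε₀, ∀ θ ∈ Set.Ioo (-a) a, θ ≠ τ ε → θ * ε - Λ θ < c ε := by
    intro ε hε θ hθ hne
    have := htan (τ ε) (hτ ε hε) θ hθ hne
    rw [hψτ ε hε] at this
    simp only [hc]
    nlinarith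
  have hle : ∀ ε ∈ Set.Ioo (-ε₀) ε₀, ∀ θ ∈ Set.Ioo (-a) a, θ * ε - Λ θ ≤ c ε := by
    intro ε hε θ hθ
    by_cases hne : θ = τ ε
    · rw [hne]
    · exact (hlt ε hε θ hθ hne).le
  -- A supremum of functions affine in `ε` is convex. It is strictly so because distinct points have
  -- distinct maximisers: `τ z` is not optimal at `x`.
  have hconv : StrictConvexOn ℝ (Set.Ioo (-ε₀) ε₀) c := by
    refine ⟨convex_Ioo _ _, fun x hx y hy hxy p q hp hq hpq => ?_⟩
    have hz : p • x + q • y ∈ Set.Ioo (-ε₀) ε₀ := convex_Ioo _ _ hx hy hp.le hq.le hpq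
    set z := p • x + q • y with hzdef
    have hzx : τ z ≠ τ x := by
      intro h
      have hzx : z = x := by rw [← hψτ z hz, ← hψτ x hx, h]
      have : q * (y - x) = 0 := by
        have e : z = p * x + q * y := hzdef
        have : p = 1 - q := by linarith
        subst this
        linarith
      rcases mul_eq_zero.1 this with h | h
      · exact hq.ne' h
      · exact hxy (by linarith)
    have h1 := hlt x hx (τ z) (hτ z hz) hzx
    have h2 := hle y hy (τ z) (hτ z hz)
    have e : c z = p * (τ z * x - Λ (τ z)) + q * (τ z * y - Λ (τ z)) := by
      have e1 : c z = τ z * (p * x + q * y) - (p + q) * Λ (τ z) := by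
        rw [hpq, one_mul]
        rfl
      rw [e1]
      ring
    rw [e, smul_eq_mul, smul_eq_mul]
    exact add_lt_add_of_lt_of_le (mul_lt_mul_of_pos_left h1 hp) (mul_le_mul_of_nonneg_left h2 hq.le)
  refine ⟨ε₀, hε₀pos, c, hconv.convexOn.continuousOn isOpen_Ioo, hconv, ?_, ?_, ?_⟩
  · intro ε hε
    have := hle ε hε 0 h0
    rwa [hΛ0, zero_mul, sub_zero] at this
  · intro ε hε
    constructor
    · intro hcz
      by_contra hne
      have hτ0 : (0 : ℝ) ≠ τ ε := by
        intro h
        exact hne (by rw [← hψτ ε hε, ← h, hψ0])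
      have := hlt ε hε 0 h0 hτ0
      rw [hΛ0, zero_mul, sub_zero, hcz] at this
      exact lt_irrefl _ this
    · rintro rfl
      have hτ0 : τ 0 = 0 := hmono.injOn (hτ 0 hε) h0 (by rw [hψτ 0 hε, hψ0])
      simp [hc, hτ0, hΛ0]
  · intro ε hε1 hε2
    have hε : ε ∈ Set.Ioo (-ε₀) ε₀ := ⟨by linarith, hε2⟩
    refine ⟨τ ε, ⟨?_, (hτ ε hε).2⟩, hψτ ε hε, by simp [hc]⟩
    by_contra hcon
    have := hmono.monotoneOn (hτ ε hε) h0 (not_lt.1 hcon)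
    rw [hψτ ε hε, hψ0] at this
    linarith

/-! ### The local Gärtner-Ellis theorem -/

theorem eventually_le_exp_of_tendsto {u : ℕ → ℝ} (hu : ∀ n, 0 < u n) {L c : ℝ}
    (h : Tendsto (fun n : ℕ => 1 / (n : ℝ) * Real.log (u n)) atTop (𝓝 L)) (hc : L < c) :
    ∀ᶠ n : ℕ in atTop, u n ≤ Real.exp (n * c) := by
  filter_upwards [h.eventually_lt_const hc, eventually_gt_atTop 0] with n hn hn0
  have hn0' : (0 : ℝ) < n := by exact_mod_cast hn0
  rw [← Real.log_le_iff_le_exp (hu n)]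
  rw [one_div, inv_mul_lt_iff₀ hn0'] at hn
  exact hn.le

theorem eventually_exp_le_of_tendsto {u : ℕ → ℝ} (hu : ∀ n, 0 < u n) {L c : ℝ}
    (h : Tendsto (fun n : ℕ => 1 / (n : ℝ) * Real.log (u n)) atTop (𝓝 L)) (hc : c < L) :
    ∀ᶠ n : ℕ in atTop, Real.exp (n * c) ≤ u n := by
  filter_upwards [h.eventually_const_lt hc, eventually_gt_atTop 0] with n hn hn0
  have hn0' : (0 : ℝ) < n := by exact_mod_cast hn0
  rw [← Real.le_log_iff_exp_le (hu n)]
  rw [one_div, lt_inv_mul_iff₀ hn0'] at hn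
  exact hn.le

theorem eventually_const_mul_exp_le {c c' K : ℝ} (hc : c < c') :
    ∀ᶠ n : ℕ in atTop, K * Real.exp (n * c) ≤ Real.exp (n * c') := by
  have h : Tendsto (fun n : ℕ => Real.exp (n * (c' - c))) atTop atTop :=
    Real.tendsto_exp_atTop.comp (tendsto_natCast_atTop_atTop.atTop_mul_const (by linarith))
  filter_upwards [h.eventually_ge_atTop K] with n hn
  calc K * Real.exp (n * c) ≤ Real.exp (n * (c' - c)) * Real.exp (n * c) := by gcongr
    _ = Real.exp (n * c') := by rw [← Real.exp_add]; ring_nf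

/-- A local Gärtner-Ellis theorem. -/
theorem tendsto_log_measure_gt {X : Type*} [MeasurableSpace X] {ν : Measure X}
    [IsProbabilityMeasure ν] {S : ℕ → X → ℝ} (hS : ∀ n, AEMeasurable (S n) ν)
    (hint : ∀ n (θ : ℝ), Integrable (fun x => Real.exp (θ * S n x)) ν)
    {Λ ψ : ℝ → ℝ} {a : ℝ}
    (hlim : ∀ θ ∈ Set.Ioo (-a) a, Tendsto
      (fun n : ℕ => 1 / (n : ℝ) * Real.log (∫ x, Real.exp (θ * S n x) ∂ν)) atTop (𝓝 (Λ θ)))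
    (hΛc : ContinuousOn Λ (Set.Ioo (-a) a)) (hψc : ContinuousOn ψ (Set.Ioo (-a) a))
    (htan : ∀ t ∈ Set.Ioo (-a) a, ∀ θ ∈ Set.Ioo (-a) a, θ ≠ t → Λ t + ψ t * (θ - t) < Λ θ)
    {t : ℝ} (ht : t ∈ Set.Ioo 0 a) :
    Tendsto (fun n : ℕ => 1 / (n : ℝ) * Real.log (ν.real {x | (n : ℝ) * ψ t < S n x})) atTop
      (𝓝 (Λ t - t * ψ t)) := by
  set u : ℝ → ℕ → ℝ := fun θ n => ∫ x, Real.exp (θ * S n x) ∂ν with hu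
  have hupos : ∀ θ n, 0 < u θ n := fun θ n => integral_exp_pos (hint n θ)
  have hta : t ∈ Set.Ioo (-a) a := ⟨by linarith [ht.1, ht.2], ht.2⟩
  have hnull : ∀ n : ℕ, NullMeasurableSet {x | (n : ℝ) * ψ t < S n x} ν := fun n =>
    nullMeasurableSet_lt aemeasurable_const (hS n)
  -- Chernoff's bound with the parameter `t`.
  have hupper : ∀ n : ℕ, ν.real {x | (n : ℝ) * ψ t < S n x} ≤ Real.exp (-t * (n * ψ t)) * u t n := by
    intro n
    refine (measureReal_mono (fun x hx => ?_)).trans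
      (ProbabilityTheory.measure_ge_le_exp_mul_mgf (X := S n) (n * ψ t) ht.1.le (hint n t))
    exact (show (n : ℝ) * ψ t < S n x from hx).le
  -- Tilt by `s = t + δ` and use `t` and `r = t + 2δ` as neighbours. In `E[e^{s S_n}]`, the part
  -- with `S_n ≤ n ψ t` is controlled by the parameter `t`, the part with `S_n > n ψ r` by `r`. The
  -- strict tangent inequalities make both exponentially smaller than `e^{n Λ s}`, so the window
  -- between them carries the expectation; there `e^{s S_n} ≤ e^{s n ψ r}`. Finally `δ → 0`.
  have hlower : ∀ y < Λ t - t * ψ t,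
      ∀ᶠ n : ℕ in atTop, Real.exp (n * y) ≤ ν.real {x | (n : ℝ) * ψ t < S n x} := by
    intro y hy
    have hnhds : Set.Ioo (-a) a ∈ 𝓝 t := Ioo_mem_nhds hta.1 hta.2
    have hcont : ContinuousAt (fun δ => Λ (t + δ) - (t + δ) * ψ (t + 2 * δ)) 0 := by
      have c1 : ContinuousAt (fun δ : ℝ => Λ (t + δ)) 0 :=
        ContinuousAt.comp' (by simpa using hΛc.continuousAt hnhds) (by fun_prop)
      have c2 : ContinuousAt (fun δ : ℝ => ψ (t + 2 * δ)) 0 :=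
        ContinuousAt.comp' (by simpa using hψc.continuousAt hnhds) (by fun_prop)
      exact c1.sub (ContinuousAt.mul (by fun_prop) c2)
    have hev : ∀ᶠ δ in 𝓝[>] (0 : ℝ), y < Λ (t + δ) - (t + δ) * ψ (t + 2 * δ) :=
      (hcont.eventually_const_lt (by simpa using hy)).filter_mono nhdsWithin_le_nhds
    have hev2 : ∀ᶠ δ in 𝓝[>] (0 : ℝ), δ ∈ Set.Ioo 0 ((a - t) / 2) :=
      Ioo_mem_nhdsGT (by linarith [ht.2])
    obtain ⟨δ, hδy, hδ0, hδa⟩ := (hev.and hev2).exists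
    set s := t + δ with hs
    set r := t + 2 * δ with hr
    have hsa : s ∈ Set.Ioo (-a) a := ⟨by linarith [hta.1], by linarith⟩
    have hra : r ∈ Set.Ioo (-a) a := ⟨by linarith [hta.1], by linarith⟩
    have hts := htan t hta s hsa (by linarith)
    have hrs := htan r hra s hsa (by linarith)
    obtain ⟨c', hc'1, hc'2⟩ : ∃ c', max (max (Λ t + ψ t * (s - t)) (Λ r + ψ r * (s - r)))
        (y + s * ψ r) < c' ∧ c' < Λ s := exists_between (by
      refine max_lt (max_lt hts hrs) (by linarith))
    obtain ⟨h12, h3⟩ := max_lt_iff.1 hc'1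
    obtain ⟨h1, h2⟩ := max_lt_iff.1 h12
    obtain ⟨c, hc1, hc2⟩ := exists_between h12
    obtain ⟨hct, hcr⟩ := max_lt_iff.1 hc1
    have hkey : ∀ n : ℕ, u s n ≤ Real.exp (s * (n * ψ r)) * ν.real {x | (n : ℝ) * ψ t < S n x} +
        Real.exp (n * ((s - t) * ψ t)) * u t n + Real.exp (n * ((s - r) * ψ r)) * u r n := by
      intro n
      have i1 : Integrable (fun x => Real.exp (s * (n * ψ r)) *
          ({x | (n : ℝ) * ψ t < S n x}.indicator (fun _ => (1 : ℝ)) x)) ν :=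
        ((integrable_const (1 : ℝ)).indicator₀ (hnull n)).const_mul _
      have i2 := (hint n t).const_mul (Real.exp (n * ((s - t) * ψ t)))
      have i3 := (hint n r).const_mul (Real.exp (n * ((s - r) * ψ r)))
      have i12 : Integrable (fun x => Real.exp (s * (n * ψ r)) *
          ({x | (n : ℝ) * ψ t < S n x}.indicator (fun _ => (1 : ℝ)) x) +
          Real.exp (n * ((s - t) * ψ t)) * Real.exp (t * S n x)) ν := i1.add i2
      have e1 : ∫ x, {x | (n : ℝ) * ψ t < S n x}.indicator (fun _ => (1 : ℝ)) x ∂ν =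
          ν.real {x | (n : ℝ) * ψ t < S n x} := by
        rw [integral_indicator₀ (hnull n)]
        simp
      rw [← e1, hu]
      simp only
      rw [← integral_const_mul, ← integral_const_mul, ← integral_const_mul,
        ← integral_add i1 i2, ← integral_add i12 i3]
      refine integral_mono (hint n s) (i12.add i3) fun x => ?_
      simp only [← Real.exp_add]
      by_cases hx : (n : ℝ) * ψ t < S n x
      · rw [Set.indicator_of_mem (show x ∈ {x | (n : ℝ) * ψ t < S n x} from hx), mul_one]
        by_cases hx' : S n x ≤ n * ψ r
        · have : Real.exp (s * S n x) ≤ Real.exp (s * (n * ψ r)) := by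
            have : 0 < s := by linarith [ht.1]
            gcongr
          linarith [Real.exp_pos (n * ((s - t) * ψ t) + t * S n x),
            Real.exp_pos (n * ((s - r) * ψ r) + r * S n x)]
        · have : Real.exp (s * S n x) ≤ Real.exp (n * ((s - r) * ψ r) + r * S n x) := by
            refine Real.exp_le_exp.2 ?_
            have : 0 ≤ (r - s) * (S n x - n * ψ r) :=
              mul_nonneg (by linarith) (by linarith)
            linarith
          linarith [Real.exp_pos (n * ((s - t) * ψ t) + t * S n x),
            Real.exp_pos (s * (n * ψ r))]
      · rw [Set.indicator_of_notMem (show x ∉ {x | (n : ℝ) * ψ t < S n x} from hx), mul_zero]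
        have : Real.exp (s * S n x) ≤ Real.exp (n * ((s - t) * ψ t) + t * S n x) := by
          refine Real.exp_le_exp.2 ?_
          have : 0 ≤ (s - t) * (n * ψ t - S n x) := mul_nonneg (by linarith) (by linarith)
          linarith
        linarith [Real.exp_pos (n * ((s - r) * ψ r) + r * S n x)]
    have et := eventually_le_exp_of_tendsto (hupos t) (hlim t hta)
      (show Λ t < c - ψ t * (s - t) by linarith)
    have er := eventually_le_exp_of_tendsto (hupos r) (hlim r hra)
      (show Λ r < c - ψ r * (s - r) by linarith)
    have es := eventually_exp_le_of_tendsto (hupos s) (hlim s hsa) hc'2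
    -- With `4` the two error terms together are at most half of `e^{n c'}`; the `2` in the next
    -- line absorbs the resulting factor in `b3`.
    have ec := eventually_const_mul_exp_le (K := 4) hc2
    have ey := eventually_const_mul_exp_le (K := 2) (show y < c' - s * ψ r by linarith)
    filter_upwards [et, er, es, ec, ey] with n ht hr hs hc hy
    have b1 : Real.exp (n * ((s - t) * ψ t)) * u t n ≤ Real.exp (n * c) := by
      calc _ ≤ Real.exp (n * ((s - t) * ψ t)) * Real.exp (n * (c - ψ t * (s - t))) := by gcongr
        _ = Real.exp (n * c) := by rw [← Real.exp_add]; ring_nf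
    have b2 : Real.exp (n * ((s - r) * ψ r)) * u r n ≤ Real.exp (n * c) := by
      calc _ ≤ Real.exp (n * ((s - r) * ψ r)) * Real.exp (n * (c - ψ r * (s - r))) := by gcongr
        _ = Real.exp (n * c) := by rw [← Real.exp_add]; ring_nf
    have b3 : Real.exp (n * c') ≤
        2 * (Real.exp (s * (n * ψ r)) * ν.real {x | (n : ℝ) * ψ t < S n x}) := by
      linarith [hkey n]
    have b4 : Real.exp (n * (c' - s * ψ r)) * Real.exp (s * (n * ψ r)) = Real.exp (n * c') := by
      rw [← Real.exp_add]; ring_nf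
    have b5 : 0 < Real.exp (s * (n * ψ r)) := Real.exp_pos _
    refine le_of_mul_le_mul_right ?_ b5
    nlinarith
  -- Needed because `Real.log 0 = 0` would spoil the upper bound on the logarithm.
  have hνpos : ∀ᶠ n : ℕ in atTop, 0 < ν.real {x | (n : ℝ) * ψ t < S n x} :=
    (hlower (Λ t - t * ψ t - 1) (by linarith)).mono fun n hn => (Real.exp_pos _).trans_le hn
  rw [tendsto_order]
  constructor
  · intro y hy
    obtain ⟨y', hy1, hy2⟩ := exists_between hy
    filter_upwards [hlower y' hy2, eventually_gt_atTop 0] with n hn hn0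
    have hn0' : (0 : ℝ) < n := by exact_mod_cast hn0
    rw [one_div, lt_inv_mul_iff₀ hn0']
    have := (Real.le_log_iff_exp_le ((Real.exp_pos _).trans_le hn)).2 hn
    nlinarith
  · intro y hy
    filter_upwards [hνpos, (hlim t hta).eventually_lt_const (show Λ t < y + t * ψ t by linarith),
      eventually_gt_atTop 0] with n hn hlt hn0
    have hn0' : (0 : ℝ) < n := by exact_mod_cast hn0
    rw [one_div, inv_mul_lt_iff₀ hn0'] at hlt ⊢
    have := Real.log_le_log hn (hupper n)
    rw [Real.log_mul (Real.exp_ne_zero _) (hupos t n).ne', Real.log_exp] at this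
    change Real.log (u t n) < _ at hlt
    nlinarith

/-! ### Densities and the integral functional -/

/-- The limit of the iterates of a nonnegative function is nonnegative. -/
theorem ae_eq_ofReal_of_setIntegral_nonneg {X : Type*} [MeasurableSpace X]
    {m : Measure X} {g : Lp ℂ 1 m}
    (hg : ∀ s, MeasurableSet s → ∃ r : ℝ, 0 ≤ r ∧ ∫ x in s, (g : X → ℂ) x ∂m = r) :
    ∃ ρ : X → ℝ, Integrable ρ m ∧ 0 ≤ᵐ[m] ρ ∧ (g : X → ℂ) =ᵐ[m] fun x => (ρ x : ℂ) := by
  have hint : Integrable (g : X → ℂ) m := L1.integrable_coeFn g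
  have hre : ∀ s, MeasurableSet s → ∃ r : ℝ, 0 ≤ r ∧ ∫ x in s, ((g : X → ℂ) x).re ∂m = r ∧
      ∫ x in s, ((g : X → ℂ) x).im ∂m = 0 := by
    intro s hs
    obtain ⟨r, hr, he⟩ := hg s hs
    refine ⟨r, hr, ?_, ?_⟩
    · have := integral_re (hint.restrict (s := s))
      simp only [RCLike.re_eq_complex_re] at this
      rw [this, he, Complex.ofReal_re]
    · have := integral_im (hint.restrict (s := s))
      simp only [RCLike.im_eq_complex_im] at this
      rw [this, he, Complex.ofReal_im]
  refine ⟨fun x => ((g : X → ℂ) x).re, hint.re, ?_, ?_⟩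
  · refine ae_nonneg_of_forall_setIntegral_nonneg hint.re fun s hs _ => ?_
    obtain ⟨r, hr, he, -⟩ := hre s hs
    exact he ▸ hr
  · have him : (fun x => ((g : X → ℂ) x).im) =ᵐ[m] fun _ => (0 : ℝ) := by
      refine Integrable.ae_eq_of_forall_setIntegral_eq _ _ hint.im (integrable_zero _ _ _)
        fun s hs _ => ?_
      obtain ⟨r, -, -, h0⟩ := hre s hs
      rw [integral_zero]
      exact h0
    filter_upwards [him] with x hx
    exact Complex.ext (by simp) (by simpa using hx)

theorem eq_of_coeFn_ae_eq {X : Type*} [MeasurableSpace X] {m : Measure X} {B : Type*}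
    [NormedAddCommGroup B] [NormedSpace ℂ B] {ι : B →L[ℂ] Lp ℂ 1 m} (hinj : Function.Injective ι) {f g : B}
   
    (h : (ι f : X → ℂ) =ᵐ[m] ι g) : f = g :=
  hinj (Lp.ext h)

/-- The functional `f ↦ ∫ f dm` on `B`. -/
noncomputable def integralFunctional {X : Type*} [MeasurableSpace X] {m : Measure X}
    {B : Type*} [NormedAddCommGroup B] [NormedSpace ℂ B] (ι : B →L[ℂ] Lp ℂ 1 m) : B →L[ℂ] ℂ :=
  LinearMap.mkContinuous
    { toFun := fun f => ∫ x, (ι f : X → ℂ) x ∂m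
      map_add' := fun f g => by
        rw [map_add, integral_congr_ae (Lp.coeFn_add _ _)]
        exact integral_add (L1.integrable_coeFn _) (L1.integrable_coeFn _)
      map_smul' := fun c f => by
        rw [map_smul, integral_congr_ae (Lp.coeFn_smul _ _)]
        exact integral_smul c (ι f : X → ℂ) }
    ‖ι‖ fun f => by
      refine (norm_integral_le_integral_norm _).trans ?_
      rw [← L1.norm_eq_integral_norm]
      exact ι.le_opNorm f

theorem integralFunctional_apply {X : Type*} [MeasurableSpace X] {m : Measure X}
    {B : Type*} [NormedAddCommGroup B] [NormedSpace ℂ B] (ι : B →L[ℂ] Lp ℂ 1 m) (f : B) :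
    integralFunctional ι f = ∫ x, (ι f : X → ℂ) x ∂m := rfl

/-! ### Spectral decomposition of the transfer operator and the invariant measure -/

section TransferOnBanachSpace

variable {X : Type*} [MeasurableSpace X] {m : Measure X} [IsProbabilityMeasure m] {T : X → X}
  {B : Type*} [NormedAddCommGroup B] [NormedSpace ℂ B] {ι : B →L[ℂ] Lp ℂ 1 m} {P : B →L[ℂ] B}

theorem integralFunctional_transfer (hT : Measure.QuasiMeasurePreserving T m m)
    (hP : ∀ f : B, ι (P f) = transfer m T (ι f)) (f : B) :
    integralFunctional ι (P f) = integralFunctional ι f := by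
  have := setIntegral_transfer hT (ι f) MeasurableSet.univ
  rw [integralFunctional_apply, integralFunctional_apply, hP]
  simpa using this

/-- Every nonzero `proj i` produces eigenvectors for `ev i`, so `ev i = 1`. The sum of the
projections then maps into the one-dimensional eigenspace of `1`, and the invariant functional `mi`
identifies it as `f ↦ mi f • h₀`. -/
theorem IsQuasiCompactDiagonal.exists_rank_one_decomposition [CompleteSpace B]
    (hqc : IsQuasiCompactDiagonal P) (hsimple : HasSimplePeripheralEigenvalueOne P)
    {mi : B →L[ℂ] ℂ} (hmi : ∀ f, mi (P f) = mi f) {e : B} (he : mi e = 1) :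
    ∃ (h₀ : B) (Q : B →L[ℂ] B), (∀ f, P f = mi f • h₀ + Q f) ∧ mi h₀ = 1 ∧ Q h₀ = 0 ∧
      (∀ f, mi (Q f) = 0) ∧ spectralRadius ℂ Q < 1 := by
  obtain ⟨s, ev, proj, Q, hPeq, hev, hidem, -, hortho, hQ, hQp⟩ := hqc
  have hev1 : ∀ i, ev i • proj i = proj i := by
    intro i
    by_cases h0 : proj i = 0
    · rw [h0, smul_zero]
    · obtain ⟨w, hw⟩ : ∃ w, proj i w ≠ 0 := by
        by_contra hcon
        push Not at hcon
        exact h0 (ContinuousLinearMap.ext hcon)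
      have hPw : P * proj i = ev i • proj i := by
        rw [hPeq, add_mul, (hQp i).1, add_zero, Finset.sum_mul, Finset.sum_eq_single i]
        · rw [smul_mul_assoc, hidem]
        · intro j _ hj
          rw [smul_mul_assoc, hortho j i hj, smul_zero]
        · simp
      have hone := hsimple.2 (ev i) (hev i) (Module.End.hasEigenvalue_of_hasEigenvector
        (x := proj i w) ⟨Module.End.mem_eigenspace_iff.2 (by
          have := congrArg (fun F : B →L[ℂ] B => F w) hPw
          simpa using this), hw⟩)
      rw [hone, one_smul]
  set Pi : B →L[ℂ] B := ∑ i, proj i with hPi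
  have hPQ : P = Pi + Q := by rw [hPeq, hPi, Finset.sum_congr rfl fun i _ => hev1 i]
  have hPi2 : Pi * Pi = Pi := by
    rw [hPi, Finset.sum_mul]
    refine Finset.sum_congr rfl fun i _ => ?_
    rw [Finset.mul_sum, Finset.sum_eq_single i, hidem]
    · intro j _ hj
      exact hortho i j hj.symm
    · simp
  have hQPi : Q * Pi = 0 := by
    rw [hPi, Finset.mul_sum]
    exact Finset.sum_eq_zero fun i _ => (hQp i).1
  have hPiQ : Pi * Q = 0 := by
    rw [hPi, Finset.sum_mul]
    exact Finset.sum_eq_zero fun i _ => (hQp i).2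
  have hPPi : P * Pi = Pi := by rw [hPQ, add_mul, hPi2, hQPi, add_zero]
  have hpow : ∀ n, P ^ (n + 1) = Pi + Q ^ (n + 1) := by
    intro n
    induction n with
    | zero => simpa using hPQ
    | succ n ih =>
      rw [pow_succ', ih, mul_add, hPPi, hPQ, add_mul, pow_succ' Q n, ← mul_assoc Pi, hPiQ, zero_mul,
        zero_add, ← pow_succ' Q n, ← pow_succ']
  have hmipow : ∀ n f, mi ((P ^ n) f) = mi f := by
    intro n f
    induction n with
    | zero => simp
    | succ n ih => rw [pow_succ', mul_apply_eq_comp, hmi, ih]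
  -- The value `mi ((P ^ n) f)` does not depend on `n`, while `(P ^ n) f` converges to `Pi f`.
  have hmiPi : ∀ f, mi (Pi f) = mi f := by
    intro f
    have h1 : Tendsto (fun n => mi ((Pi + Q ^ (n + 1)) f)) atTop (𝓝 (mi ((Pi + 0) f))) := by
      have hc : Continuous fun F : B →L[ℂ] B => mi ((Pi + F) f) := by fun_prop
      exact (hc.tendsto 0).comp
        ((tendsto_pow_zero_of_spectralRadius_lt_one hQ).comp (tendsto_add_atTop_nat 1))
    simp_rw [← hpow, hmipow, add_zero] at h1
    exact (tendsto_nhds_unique h1 tendsto_const_nhds)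
  have hmih : mi (Pi e) = 1 := by rw [hmiPi, he]
  have hh0 : Pi e ≠ 0 := by
    intro h
    rw [h, map_zero] at hmih
    exact zero_ne_one hmih
  have hmem : ∀ f, Pi f ∈ Module.End.eigenspace (P : B →ₗ[ℂ] B) 1 := by
    intro f
    rw [Module.End.mem_eigenspace_iff, one_smul]
    exact congrArg (fun F : B →L[ℂ] B => F f) hPPi
  have hPif : ∀ f, Pi f = mi f • Pi e := by
    intro f
    obtain ⟨c, hc⟩ := (finrank_eq_one_iff_of_nonzero' (⟨Pi e, hmem e⟩ :
      Module.End.eigenspace (P : B →ₗ[ℂ] B) 1) (by simpa using hh0)).1 hsimple.1 ⟨Pi f, hmem f⟩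
    have hc' : c • Pi e = Pi f := congrArg Subtype.val hc
    have := congrArg mi hc'
    rw [map_smul, hmih, hmiPi, smul_eq_mul, mul_one] at this
    rw [← hc', this]
  refine ⟨Pi e, Q, ?_, hmih, congrArg (fun F : B →L[ℂ] B => F e) hQPi, ?_, hQ⟩
  · intro f
    rw [← hPif, hPQ]
    rfl
  · intro f
    have := hmi f
    rw [hPQ, add_apply, map_add, hmiPi] at this
    simpa using this

theorem tendsto_pow_apply [CompleteSpace B] {mi : B →L[ℂ] ℂ} {h₀ : B} {Q : B →L[ℂ] B}
    (hPQ : ∀ f, P f = mi f • h₀ + Q f) (h1 : mi h₀ = 1) (hQ0 : Q h₀ = 0)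
    (hmQ : ∀ f, mi (Q f) = 0) (hQ : spectralRadius ℂ Q < 1) (f : B) :
    Tendsto (fun n => (P ^ n) f) atTop (𝓝 (mi f • h₀)) := by
  -- The splitting starts at the first power: at the zeroth, the right-hand side would be `mi f • h₀
  -- + f`.
  have hpow : ∀ n, (P ^ (n + 1)) f = mi f • h₀ + (Q ^ (n + 1)) f := by
    intro n
    induction n with
    | zero => simpa using hPQ f
    | succ n ih =>
      rw [pow_succ', mul_apply_eq_comp, ih, hPQ, map_add, map_smul, map_add, map_smul, h1, hQ0,
        pow_succ' Q (n + 1), mul_apply_eq_comp, pow_succ' Q n, mul_apply_eq_comp, hmQ]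
      simp
  refine (tendsto_add_atTop_iff_nat 1).1 ?_
  simp_rw [hpow]
  have hc : Continuous fun F : B →L[ℂ] B => mi f • h₀ + F f := by fun_prop
  have := (hc.tendsto 0).comp
    ((tendsto_pow_zero_of_spectralRadius_lt_one hQ).comp (tendsto_add_atTop_nat 1))
  simpa only [Function.comp_def, zero_apply, add_zero] using this

theorem setIntegral_pow_transfer (hT : Measure.QuasiMeasurePreserving T m m)
    (hP : ∀ f : B, ι (P f) = transfer m T (ι f)) (n : ℕ) (f : B) {A : Set X}
    (hA : MeasurableSet A) :
    ∫ x in A, (ι ((P ^ n) f) : X → ℂ) x ∂m = ∫ x in T^[n] ⁻¹' A, (ι f : X → ℂ) x ∂m := by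
  induction n generalizing A with
  | zero => simp
  | succ n ih =>
    rw [pow_succ', mul_apply_eq_comp, hP, setIntegral_transfer hT _ hA, ih (hT.measurable hA),
      Function.iterate_succ', Set.preimage_comp]

theorem integral_density_mul {ν : Measure X} [IsProbabilityMeasure ν] (hν : ν ≪ m) {g : B}
    (hg : (ι g : X → ℂ) =ᵐ[m] fun x => (((ν.rnDeriv m x).toReal : ℝ) : ℂ)) (F : X → ℂ) :
    ∫ x, (ι g : X → ℂ) x * F x ∂m = ∫ x, F x ∂ν := by
  rw [← integral_rnDeriv_smul hν]
  refine integral_congr_ae ?_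
  filter_upwards [hg] with x hx
  rw [hx, Complex.real_smul]

theorem setIntegral_density {ν : Measure X} [IsProbabilityMeasure ν] (hν : ν ≪ m) {g : B}
    (hg : (ι g : X → ℂ) =ᵐ[m] fun x => (((ν.rnDeriv m x).toReal : ℝ) : ℂ)) (A : Set X) :
    ∫ x in A, (ι g : X → ℂ) x ∂m = ν.real A := by
  rw [← Measure.setIntegral_toReal_rnDeriv hν A, ← integral_complex_ofReal]
  exact integral_congr_ae (ae_restrict_of_ae hg)

/-- By duality, the integral of `P g` over `A` is `ν (T⁻¹ A)`, that of `g` is `ν A`; integrals over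
all measurable sets determine a density. -/
theorem measurePreserving_iff_density_fixed (hinj : Function.Injective ι)
    (hT : Measure.QuasiMeasurePreserving T m m)
    (hP : ∀ f : B, ι (P f) = transfer m T (ι f)) {ν : Measure X} [IsProbabilityMeasure ν]
    (hν : ν ≪ m) {g : B}
    (hg : (ι g : X → ℂ) =ᵐ[m] fun x => (((ν.rnDeriv m x).toReal : ℝ) : ℂ)) :
    MeasurePreserving T ν ν ↔ P g = g := by
  have key : ∀ A, MeasurableSet A →
      ∫ x in A, (ι (P g) : X → ℂ) x ∂m = ν.real (T ⁻¹' A) := by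
    intro A hA
    rw [hP, setIntegral_transfer hT _ hA, setIntegral_density hν hg]
  constructor
  · intro h
    refine eq_of_coeFn_ae_eq hinj ?_
    refine Integrable.ae_eq_of_forall_setIntegral_eq _ _ (L1.integrable_coeFn _)
      (L1.integrable_coeFn _) fun A hA _ => ?_
    rw [key A hA, setIntegral_density hν hg, measureReal_def, measureReal_def,
      h.measure_preimage hA.nullMeasurableSet]
  · intro h
    refine ⟨hT.measurable, Measure.ext fun A hA => ?_⟩
    have := key A hA
    rw [h, setIntegral_density hν hg] at this
    rw [Measure.map_apply hT.measurable hA]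
    have h2 : ν.real A = ν.real (T ⁻¹' A) := by exact_mod_cast this
    exact ((measureReal_eq_measureReal_iff).1 h2).symm

theorem fixed_eq_of_integralFunctional_eq_one [CompleteSpace B] {mi : B →L[ℂ] ℂ} {h₀ : B}
    {Q : B →L[ℂ] B}
    (hPQ : ∀ f, P f = mi f • h₀ + Q f) (h1 : mi h₀ = 1) (hQ0 : Q h₀ = 0)
    (hmQ : ∀ f, mi (Q f) = 0) (hQ : spectralRadius ℂ Q < 1) {g : B} (hg : P g = g)
    (hmg : mi g = 1) : g = h₀ := by
  have hlim := tendsto_pow_apply hPQ h1 hQ0 hmQ hQ g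
  have hpow : ∀ n, (P ^ n) g = g := by
    intro n
    induction n with
    | zero => simp
    | succ n ih => rw [pow_succ', mul_apply_eq_comp, ih, hg]
  simp_rw [hpow, hmg, one_smul] at hlim
  exact tendsto_nhds_unique tendsto_const_nhds hlim

theorem integralFunctional_density {ν : Measure X} [IsProbabilityMeasure ν] (hν : ν ≪ m) {g : B}
    (hg : (ι g : X → ℂ) =ᵐ[m] fun x => (((ν.rnDeriv m x).toReal : ℝ) : ℂ)) :
    integralFunctional ι g = 1 := by
  have := setIntegral_density hν hg Set.univ
  rw [integralFunctional_apply]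
  simpa using this

/-- The iterates `P ^ n 1` converge to `h₀`, and their integral over `s` is `m (T^{-n} s) ≥ 0`, so
`h₀` is a probability density. Any other invariant density in `B` is a fixed point of `P` with
integral one, hence equals `h₀`. -/
theorem existsUnique_isAcip [CompleteSpace B] (hB : IsBanachAlgebraLattice ι)
    (hT : Measure.QuasiMeasurePreserving T m m)
    (hP : ∀ f : B, ι (P f) = transfer m T (ι f)) {h₀ : B} {Q : B →L[ℂ] B}
    (hPQ : ∀ f, P f = integralFunctional ι f • h₀ + Q f) (h1 : integralFunctional ι h₀ = 1)
    (hQ0 : Q h₀ = 0) (hmQ : ∀ f, integralFunctional ι (Q f) = 0)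
    (hQ : spectralRadius ℂ Q < 1) : ∃! μ : Measure X, IsAcip T ι μ := by
  obtain ⟨e, he⟩ := hB.const_mem 1
  have hmie : integralFunctional ι e = 1 := by
    rw [integralFunctional_apply, integral_congr_ae he]
    simp
  have hlim := tendsto_pow_apply hPQ h1 hQ0 hmQ hQ e
  rw [hmie, one_smul] at hlim
  have hnonneg : ∀ s, MeasurableSet s → ∃ r : ℝ, 0 ≤ r ∧ ∫ x in s, (ι h₀ : X → ℂ) x ∂m = r := by
    intro s hs
    have hl : Tendsto (fun n => ∫ x in s, (ι ((P ^ n) e) : X → ℂ) x ∂m) atTop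
        (𝓝 (∫ x in s, (ι h₀ : X → ℂ) x ∂m)) :=
      (((continuous_setIntegral s).comp ι.continuous).tendsto h₀).comp hlim
    have hval : ∀ n, ∫ x in s, (ι ((P ^ n) e) : X → ℂ) x ∂m = (m.real (T^[n] ⁻¹' s) : ℂ) := by
      intro n
      rw [setIntegral_pow_transfer hT hP n e hs, integral_congr_ae (ae_restrict_of_ae he)]
      simp
    simp_rw [hval] at hl
    have hre := (Complex.continuous_re.tendsto _).comp hl
    have him := (Complex.continuous_im.tendsto _).comp hl
    refine ⟨(∫ x in s, (ι h₀ : X → ℂ) x ∂m).re,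
      ge_of_tendsto' hre fun n => by simp, Complex.ext (by simp) ?_⟩
    refine tendsto_nhds_unique him ?_
    simp [Function.comp_def]
  obtain ⟨ρ, hρint, hρ0, hρ⟩ := ae_eq_ofReal_of_setIntegral_nonneg hnonneg
  set μ : Measure X := m.withDensity fun x => ENNReal.ofReal (ρ x) with hμ
  have hμm : μ ≪ m := withDensity_absolutelyContinuous _ _
  have hρ1 : ∫ x, ρ x ∂m = 1 := by
    have := h1
    rw [integralFunctional_apply, integral_congr_ae hρ, integral_complex_ofReal] at this
    exact_mod_cast this
  have hprob : IsProbabilityMeasure μ := by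
    refine ⟨?_⟩
    rw [hμ, withDensity_apply _ MeasurableSet.univ, Measure.restrict_univ,
      ← ofReal_integral_eq_lintegral_ofReal hρint hρ0, hρ1, ENNReal.ofReal_one]
  have hdens : (ι h₀ : X → ℂ) =ᵐ[m] fun x => (((μ.rnDeriv m x).toReal : ℝ) : ℂ) := by
    filter_upwards [hρ, hρ0, Measure.rnDeriv_withDensity₀ m
      hρint.aestronglyMeasurable.aemeasurable.ennreal_ofReal] with x hx hx0 hxr
    rw [hx, hxr, ENNReal.toReal_ofReal hx0]
  have hPh : P h₀ = h₀ := by rw [hPQ, h1, hQ0, one_smul, add_zero]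
  refine ⟨μ, ⟨⟨hprob, hμm, h₀, hdens⟩,
    (measurePreserving_iff_density_fixed hB.injective hT hP hμm hdens).2 hPh⟩, ?_⟩
  rintro μ' ⟨⟨hprob', hμm', g, hg⟩, hinv⟩
  have hPg := (measurePreserving_iff_density_fixed hB.injective hT hP hμm' hg).1 hinv
  have hgh : g = h₀ := fixed_eq_of_integralFunctional_eq_one hPQ h1 hQ0 hmQ hQ hPg
    (integralFunctional_density hμm' hg)
  subst hgh
  refine Measure.ext fun A _ => ?_
  have h2 : μ'.real A = μ.real A := by
    have := (setIntegral_density hμm' hg A).symm.trans (setIntegral_density hμm hdens A)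
    exact_mod_cast this
  exact (measureReal_eq_measureReal_iff).1 h2

end TransferOnBanachSpace

/-! ### Multiplication operators and their exponentials -/

theorem IsBanachAlgebraLattice.exists_mulOperator {X : Type*} [MeasurableSpace X] {m : Measure X}
    {B : Type*} [NormedAddCommGroup B] [NormedSpace ℂ B] {ι : B →L[ℂ] Lp ℂ 1 m}
    (hB : IsBanachAlgebraLattice ι) (b : B) :
    ∃ M : B →L[ℂ] B, ∀ f, (ι (M f) : X → ℂ) =ᵐ[m] fun x => (ι b : X → ℂ) x * (ι f : X → ℂ) x := by
  obtain ⟨C, -, hC⟩ := hB.mul_mem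
  choose h hae hbd using hC b
  refine ⟨LinearMap.mkContinuous { toFun := h, map_add' := ?_, map_smul' := ?_ } (C * ‖b‖) hbd, hae⟩
  · intro f g
    refine eq_of_coeFn_ae_eq hB.injective ?_
    rw [map_add]
    have e1 := Lp.coeFn_add (ι (h f)) (ι (h g))
    have e2 := Lp.coeFn_add (ι f) (ι g)
    rw [← map_add] at e2
    filter_upwards [hae f, hae g, hae (f + g), e1, e2] with x hf hg hfg h1 h2
    rw [hfg, h1, h2, Pi.add_apply, Pi.add_apply, hf, hg, mul_add]
  · intro c f
    refine eq_of_coeFn_ae_eq hB.injective ?_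
    rw [map_smul]
    have e1 := Lp.coeFn_smul c (ι (h f))
    have e2 := Lp.coeFn_smul c (ι f)
    rw [← map_smul] at e2
    filter_upwards [hae f, hae (c • f), e1, e2] with x hf hcf h1 h2
    rw [hcf, RingHom.id_apply, h1, h2, Pi.smul_apply, Pi.smul_apply, hf, smul_eq_mul, smul_eq_mul]
    ring

/-- Realising multiplication by `e^{zφ}` as an operator exponential makes it analytic in `z` in the
operator norm of `B`. The exponential series converges in `B`, hence in `L¹`, and its partial sums
are the pointwise ones almost everywhere. -/
theorem exp_mulOperator_ae_eq {X : Type*} [MeasurableSpace X] {m : Measure X}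
    {B : Type*} [NormedAddCommGroup B] [NormedSpace ℂ B] [CompleteSpace B]
    {ι : B →L[ℂ] Lp ℂ 1 m} {M : B →L[ℂ] B} {φ : X → ℂ}
    (hM : ∀ f, (ι (M f) : X → ℂ) =ᵐ[m] fun x => φ x * (ι f : X → ℂ) x) (z : ℂ) (f : B) :
    (ι (NormedSpace.exp (z • M) f) : X → ℂ) =ᵐ[m]
      fun x => Complex.exp (z * φ x) * (ι f : X → ℂ) x := by
  have hpow : ∀ n : ℕ, (ι ((M ^ n) f) : X → ℂ) =ᵐ[m] fun x => φ x ^ n * (ι f : X → ℂ) x := by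
    intro n
    induction n with
    | zero => simp
    | succ n ih =>
      rw [pow_succ', mul_apply_eq_comp]
      filter_upwards [hM ((M ^ n) f), ih] with x h1 h2
      rw [h1, h2, pow_succ']
      ring
  have hsum : HasSum (fun n : ℕ => ι (((n.factorial : ℂ)⁻¹ • (z • M) ^ n) f))
      (ι (NormedSpace.exp (z • M) f)) := by
    have h := NormedSpace.exp_series_hasSum_exp' (𝕂 := ℂ) (z • M)
    exact (h.mapL ((ContinuousLinearMap.apply ℂ B f))).mapL ι
  have hterm : ∀ n : ℕ, (ι (((n.factorial : ℂ)⁻¹ • (z • M) ^ n) f) : X → ℂ) =ᵐ[m]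
      fun x => (n.factorial : ℂ)⁻¹ * (z * φ x) ^ n * (ι f : X → ℂ) x := by
    intro n
    have e : ι (((n.factorial : ℂ)⁻¹ • (z • M) ^ n) f) =
        ((n.factorial : ℂ)⁻¹ * z ^ n) • ι ((M ^ n) f) := by
      rw [smul_pow, smul_smul, smul_apply, map_smul]
    rw [e]
    filter_upwards [Lp.coeFn_smul ((n.factorial : ℂ)⁻¹ * z ^ n) (ι ((M ^ n) f)), hpow n]
      with x h1 h2
    rw [h1, Pi.smul_apply, h2, smul_eq_mul, mul_pow]
    ring
  have hpart : ∀ N : ℕ, (∑ n ∈ Finset.range N, ι (((n.factorial : ℂ)⁻¹ • (z • M) ^ n) f) :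
      Lp ℂ 1 m) =ᵐ[m] fun x => (∑ n ∈ Finset.range N, (n.factorial : ℂ)⁻¹ * (z * φ x) ^ n) *
        (ι f : X → ℂ) x := by
    intro N
    induction N with
    | zero =>
      filter_upwards [Lp.coeFn_zero ℂ 1 m] with x hx
      simpa using hx
    | succ N ih =>
      rw [Finset.sum_range_succ]
      filter_upwards [ih, hterm N, Lp.coeFn_add
        (∑ n ∈ Finset.range N, ι (((n.factorial : ℂ)⁻¹ • (z • M) ^ n) f))
        (ι (((N.factorial : ℂ)⁻¹ • (z • M) ^ N) f))] with x h1 h2 h3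
      rw [h3, Pi.add_apply, h1, h2, Finset.sum_range_succ, add_mul]
  -- Convergence in `L¹` gives almost everywhere convergence along a subsequence, enough to identify
  -- the limit.
  obtain ⟨ns, hns, hlim⟩ :=
    (tendstoInMeasure_of_tendsto_Lp hsum.tendsto_sum_nat).exists_seq_tendsto_ae
  filter_upwards [hlim, ae_all_iff.2 hpart] with x hx hp
  refine tendsto_nhds_unique hx ?_
  simp_rw [hp]
  refine Tendsto.mul_const _ ?_
  have h := (NormedSpace.exp_series_hasSum_exp' (𝕂 := ℂ) (z * φ x)).tendsto_sum_nat
  rw [← Complex.exp_eq_exp_ℂ] at h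
  exact h.comp hns.tendsto_atTop

/-! ### Twisted transfer operators and Birkhoff sums -/

section TwistedTransfer

variable {X : Type*} [MeasurableSpace X] {m : Measure X} {T : X → X} {φ : X → ℝ} {K : ℝ}

theorem aemeasurable_birkhoffSum (hT : Measure.QuasiMeasurePreserving T m m)
    (hφ : AEMeasurable φ m) (n : ℕ) : AEMeasurable (birkhoffSum T φ n) m := by
  have : birkhoffSum T φ n = ∑ k ∈ Finset.range n, φ ∘ T^[k] := by
    ext x
    simp [birkhoffSum]
  rw [this]
  exact Finset.aemeasurable_sum _ fun k _ =>
    hφ.comp_quasiMeasurePreserving (hT.iterate k)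

theorem ae_abs_birkhoffSum_le (hT : Measure.QuasiMeasurePreserving T m m)
    (hK : ∀ᵐ x ∂m, |φ x| ≤ K) (n : ℕ) : ∀ᵐ x ∂m, |birkhoffSum T φ n x| ≤ n * K := by
  have h : ∀ k, ∀ᵐ x ∂m, |φ (T^[k] x)| ≤ K := fun k => (hT.iterate k).ae hK
  filter_upwards [ae_all_iff.2 h] with x hx
  calc |birkhoffSum T φ n x| ≤ ∑ k ∈ Finset.range n, |φ (T^[k] x)| :=
        Finset.abs_sum_le_sum_abs _ _
    _ ≤ ∑ k ∈ Finset.range n, K := Finset.sum_le_sum fun k _ => hx k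
    _ = n * K := by simp

theorem aestronglyMeasurable_cexp_birkhoffSum (hT : Measure.QuasiMeasurePreserving T m m)
    (hφ : AEMeasurable φ m) (n : ℕ) (z : ℂ) :
    AEStronglyMeasurable (fun x => Complex.exp (z * ((birkhoffSum T φ n x : ℝ) : ℂ))) m :=
  (Complex.measurable_exp.comp_aemeasurable
    ((Complex.measurable_ofReal.comp_aemeasurable
      (aemeasurable_birkhoffSum hT hφ n)).const_mul z)).aestronglyMeasurable

theorem ae_norm_cexp_birkhoffSum_le (hT : Measure.QuasiMeasurePreserving T m m)
    (hK : ∀ᵐ x ∂m, |φ x| ≤ K) (n : ℕ) (z : ℂ) :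
    ∀ᵐ x ∂m, ‖Complex.exp (z * ((birkhoffSum T φ n x : ℝ) : ℂ))‖ ≤ Real.exp (‖z‖ * (n * K)) := by
  filter_upwards [ae_abs_birkhoffSum_le hT hK n] with x hx
  rw [Complex.norm_exp]
  refine Real.exp_le_exp.2 ((Complex.re_le_norm _).trans ?_)
  rw [norm_mul, Complex.norm_real, Real.norm_eq_abs]
  gcongr

theorem integrable_exp_birkhoffSum (hT : Measure.QuasiMeasurePreserving T m m)
    (hφ : AEMeasurable φ m) (hK : ∀ᵐ x ∂m, |φ x| ≤ K) {ν : Measure X} [IsFiniteMeasure ν]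
    (hν : ν ≪ m) (n : ℕ) (θ : ℝ) :
    Integrable (fun x => Real.exp (θ * birkhoffSum T φ n x)) ν := by
  refine Integrable.of_bound (Real.measurable_exp.comp_aemeasurable
    (((aemeasurable_birkhoffSum hT hφ n).mono_ac hν).const_mul θ)).aestronglyMeasurable
    (Real.exp (|θ| * (n * K))) ?_
  filter_upwards [hν.ae_le (ae_abs_birkhoffSum_le hT hK n)] with x hx
  rw [Real.norm_eq_abs, Real.abs_exp]
  refine Real.exp_le_exp.2 ((le_abs_self _).trans ?_)
  rw [abs_mul]
  gcongr

variable [IsProbabilityMeasure m] {B : Type*} [NormedAddCommGroup B] [NormedSpace ℂ B]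
  {ι : B →L[ℂ] Lp ℂ 1 m} {P E : B →L[ℂ] B} {z : ℂ}

/-- Moving `P` across the integral composes `e^{z S_n}` with `T`; together with the factor `e^{zφ}`
from `E` this gives `e^{z S_{n+1}}`, since `S_{n+1} = φ + S_n∘T`. -/
theorem integral_twisted_pow (hT : Measure.QuasiMeasurePreserving T m m)
    (hP : ∀ f : B, ι (P f) = transfer m T (ι f)) (hφ : AEMeasurable φ m)
    (hK : ∀ᵐ x ∂m, |φ x| ≤ K)
    (hE : ∀ f, (ι (E f) : X → ℂ) =ᵐ[m] fun x => Complex.exp (z * φ x) * (ι f : X → ℂ) x)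
    (n : ℕ) (f : B) :
    integralFunctional ι (((P * E) ^ n) f) =
      ∫ x, (ι f : X → ℂ) x * Complex.exp (z * ((birkhoffSum T φ n x : ℝ) : ℂ)) ∂m := by
  induction n generalizing f with
  | zero => simp [integralFunctional_apply]
  | succ n ih =>
    rw [pow_succ, mul_apply_eq_comp, ih, mul_apply_eq_comp, hP,
      integral_transfer_mul hT _ (aestronglyMeasurable_cexp_birkhoffSum hT hφ n z)
        (ae_norm_cexp_birkhoffSum_le hT hK n z)]
    refine integral_congr_ae ?_
    filter_upwards [hE f] with x hx
    rw [hx, birkhoffSum_succ', Complex.ofReal_add, mul_add, Complex.exp_add]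
    ring

theorem integral_pow_mul (hT : Measure.QuasiMeasurePreserving T m m)
    (hP : ∀ f : B, ι (P f) = transfer m T (ι f)) (n : ℕ) (f : B) {ψ : X → ℂ}
    (hψ : AEStronglyMeasurable ψ m) {K : ℝ} (hK : ∀ᵐ x ∂m, ‖ψ x‖ ≤ K) :
    ∫ x, (ι ((P ^ n) f) : X → ℂ) x * ψ x ∂m = ∫ x, (ι f : X → ℂ) x * ψ (T^[n] x) ∂m := by
  induction n generalizing f with
  | zero => simp
  | succ n ih =>
    rw [pow_succ, mul_apply_eq_comp, ih, hP, integral_transfer_mul hT (ι f)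
      (ψ := fun x => ψ (T^[n] x)) (hψ.comp_quasiMeasurePreserving (hT.iterate n)) ((hT.iterate n).ae hK)]
    rfl

/-- Comparison of the moment generating functions of `S_{k+n}` and of `S_n` with the first `k`
steps dropped. -/
theorem exp_mul_integral_pow_le (hT : Measure.QuasiMeasurePreserving T m m)
    (hP : ∀ f : B, ι (P f) = transfer m T (ι f)) (hφ : AEMeasurable φ m)
    (hK : ∀ᵐ x ∂m, |φ x| ≤ K) {ν : Measure X} [IsProbabilityMeasure ν] (hν : ν ≪ m) {g : B}
    (hg : (ι g : X → ℂ) =ᵐ[m] fun x => (((ν.rnDeriv m x).toReal : ℝ) : ℂ)) (θ : ℝ) (k n : ℕ) :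
    Real.exp (-(|θ| * (k * K))) *
        (∫ x, (ι ((P ^ k) g) : X → ℂ) x * Complex.exp (θ * ((birkhoffSum T φ n x : ℝ) : ℂ)) ∂m).re ≤
      ∫ x, Real.exp (θ * birkhoffSum T φ (k + n) x) ∂ν := by
  rw [integral_pow_mul hT hP k g (aestronglyMeasurable_cexp_birkhoffSum hT hφ n θ)
    (ae_norm_cexp_birkhoffSum_le hT hK n θ), integral_density_mul hν hg]
  have hcast : (fun x => Complex.exp (θ * ((birkhoffSum T φ n (T^[k] x) : ℝ) : ℂ))) =
      fun x => ((Real.exp (θ * birkhoffSum T φ n (T^[k] x)) : ℝ) : ℂ) := by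
    ext x
    push_cast
    rfl
  rw [hcast, integral_complex_ofReal, Complex.ofReal_re, ← integral_const_mul]
  have hint : Integrable (fun x => Real.exp (θ * birkhoffSum T φ n (T^[k] x))) ν := by
    refine Integrable.of_bound (C := Real.exp (|θ| * (n * K)))
      (Real.measurable_exp.comp_aemeasurable
      ((((aemeasurable_birkhoffSum hT hφ n).comp_quasiMeasurePreserving
        (hT.iterate k)).mono_ac hν).const_mul θ)).aestronglyMeasurable ?_
    filter_upwards [hν.ae_le ((hT.iterate k).ae (ae_abs_birkhoffSum_le hT hK n))] with x hx
    rw [Real.norm_eq_abs, Real.abs_exp]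
    refine Real.exp_le_exp.2 ((le_abs_self _).trans ?_)
    rw [abs_mul]
    gcongr
  refine integral_mono_ae (hint.const_mul _) (integrable_exp_birkhoffSum hT hφ hK hν _ _) ?_
  filter_upwards [hν.ae_le (ae_abs_birkhoffSum_le hT hK k)] with x hx
  rw [← Real.exp_add, birkhoffSum_add, mul_add]
  refine Real.exp_le_exp.2 (add_le_add_left ?_ _)
  have h1 : |θ * birkhoffSum T φ k x| ≤ |θ| * (k * K) := by
    rw [abs_mul]
    gcongr
  linarith [neg_abs_le (θ * birkhoffSum T φ k x)]

end TwistedTransfer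

/-! ### The variance by Cauchy's estimates -/

theorem integrableExpSet_eq_univ_of_bounded {X : Type*} [MeasurableSpace X] {μ : Measure X}
    [IsFiniteMeasure μ] {S : X → ℝ} (hS : AEMeasurable S μ) {K : ℝ} (hK : ∀ᵐ x ∂μ, |S x| ≤ K) :
    ProbabilityTheory.integrableExpSet S μ = Set.univ := by
  refine Set.eq_univ_of_forall fun θ => ?_
  refine Integrable.of_bound (C := Real.exp (|θ| * K))
    (Real.measurable_exp.comp_aemeasurable (hS.const_mul θ)).aestronglyMeasurable ?_
  filter_upwards [hK] with x hx
  rw [Real.norm_eq_abs, Real.abs_exp]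
  refine Real.exp_le_exp.2 ((le_abs_self _).trans ?_)
  rw [abs_mul]
  gcongr

/-- If `E[exp (z S_n)] exp (- n L(z))` is bounded near `0`, uniformly in `n`, and the `S_n` are
centred, then `L'(0) = 0` and `E[S_n²] / n → L''(0)`. -/
theorem tendsto_second_moment_of_complexMGF_le {X : Type*} [MeasurableSpace X] {μ : Measure X}
    [IsProbabilityMeasure μ] {S : ℕ → X → ℝ}
    (hS : ∀ n, ProbabilityTheory.integrableExpSet (S n) μ = Set.univ)
    (hmean : ∀ n, ∫ x, S n x ∂μ = 0) {L : ℂ → ℂ} {r C : ℝ} (hr : 0 < r)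
    (hL : DifferentiableOn ℂ L (Metric.ball 0 r)) (hL0 : L 0 = 0)
    (hC : ∀ n, ∀ z ∈ Metric.ball (0 : ℂ) r,
      ‖ProbabilityTheory.complexMGF (S n) μ z‖ ≤ C * ‖Complex.exp (L z)‖ ^ n) :
    deriv L 0 = 0 ∧
      Tendsto (fun n : ℕ => (∫ x, S n x ^ 2 ∂μ) / n) atTop (𝓝 (deriv (deriv L) 0).re) := by
  set u : ℕ → ℕ → ℂ → ℂ := fun k n z => ∫ x, (S n x : ℂ) ^ k * Complex.exp (z * S n x) ∂μ with hu
  have hud : ∀ k n z, HasDerivAt (u k n) (u (k + 1) n z) z := fun k n z =>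
    ProbabilityTheory.hasDerivAt_integral_pow_mul_exp (by simp [hS n]) k
  have hu0 : ∀ n, u 0 n 0 = 1 := fun n => by simp [hu]
  have hu1 : ∀ n, u 1 n 0 = 0 := fun n => by
    simp only [hu, pow_one, zero_mul, Complex.exp_zero, mul_one]
    rw [integral_complex_ofReal, hmean, Complex.ofReal_zero]
  have hu2 : ∀ n, u 2 n 0 = ((∫ x, S n x ^ 2 ∂μ : ℝ) : ℂ) := fun n => by
    simp only [hu, zero_mul, Complex.exp_zero, mul_one, ← integral_complex_ofReal]
    push_cast
    rfl
  have hball : Metric.ball (0 : ℂ) r ∈ 𝓝 (0 : ℂ) := Metric.ball_mem_nhds _ hr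
  have hLd : ∀ z ∈ Metric.ball (0 : ℂ) r, HasDerivAt L (deriv L z) z := fun z hz =>
    (hL.differentiableAt (Metric.isOpen_ball.mem_nhds hz)).hasDerivAt
  have hL2 : HasDerivAt (deriv L) (deriv (deriv L) 0) 0 :=
    ((hL.deriv Metric.isOpen_ball).differentiableAt hball).hasDerivAt
  -- Dividing out the exponential growth leaves holomorphic functions bounded by `C` for all `n`, so
  -- their derivatives at `0` are bounded uniformly in `n`.
  set g : ℕ → ℂ → ℂ := fun n z => Complex.exp (-(n * L z)) * u 0 n z with hg
  have hgd : ∀ n, ∀ z ∈ Metric.ball (0 : ℂ) r, HasDerivAt (g n)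
      (Complex.exp (-(n * L z)) * (u 1 n z - n * deriv L z * u 0 n z)) z := by
    intro n z hz
    have h1 := ((((hLd z hz).const_mul (n : ℂ)).neg.cexp).mul (hud 0 n z))
    convert! h1 using 1
    simp only [Pi.neg_apply, zero_add]
    ring
  have hg1 : ∀ n, deriv (g n) 0 = -(n * deriv L 0) := by
    intro n
    rw [(hgd n 0 (Metric.mem_ball_self hr)).deriv, hL0, hu1, hu0]
    simp
  have hbound : ∀ n, ∀ z ∈ Metric.ball (0 : ℂ) r, ‖g n z‖ ≤ C := by
    intro n z hz
    have h := hC n z hz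
    have e : ProbabilityTheory.complexMGF (S n) μ z = u 0 n z := by
      simp [hu, ProbabilityTheory.complexMGF]
    rw [e, ← norm_pow, ← Complex.exp_nat_mul] at h
    simp only [hg]
    rw [norm_mul, Complex.exp_neg, norm_inv, inv_mul_le_iff₀ (norm_pos_iff.2 (Complex.exp_ne_zero _))]
    linarith
  have hr2 : 0 < r / 2 := by linarith
  have hsub : Metric.closedBall (0 : ℂ) (r / 2) ⊆ Metric.ball 0 r :=
    Metric.closedBall_subset_ball (by linarith)
  have hdc : ∀ n, DiffContOnCl ℂ (g n) (Metric.ball 0 (r / 2)) := fun n =>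
    DifferentiableOn.diffContOnCl_ball (U := Metric.ball 0 r)
      (fun z hz => (hgd n z hz).differentiableAt.differentiableWithinAt) hsub
  -- As the `S n` are centred, the first derivative of `g n` at `0` is `-n L'(0)`, bounded in `n`
  -- only if `L'(0) = 0`.
  have hL'0 : deriv L 0 = 0 := by
    have hb : ∀ n : ℕ, (n : ℝ) * ‖deriv L 0‖ ≤ C / (r / 2) := by
      intro n
      have := Complex.norm_deriv_le_of_forall_mem_sphere_norm_le hr2 (hdc n)
        (fun z hz => hbound n z (hsub (Metric.sphere_subset_closedBall hz)))
      rwa [hg1, norm_neg, norm_mul, Complex.norm_natCast] at this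
    by_contra hne
    obtain ⟨n, hn⟩ := exists_nat_gt (C / (r / 2) / ‖deriv L 0‖)
    rw [div_lt_iff₀ (norm_pos_iff.2 hne)] at hn
    linarith [hb n]
  have hg2 : ∀ n, iteratedDeriv 2 (g n) 0 =
      ((∫ x, S n x ^ 2 ∂μ : ℝ) : ℂ) - n * deriv (deriv L) 0 := by
    intro n
    have hev : deriv (g n) =ᶠ[𝓝 0] fun z =>
        Complex.exp (-(n * L z)) * (u 1 n z - n * deriv L z * u 0 n z) := by
      filter_upwards [hball] with z hz using (hgd n z hz).deriv
    rw [iteratedDeriv_succ, iteratedDeriv_one, hev.deriv_eq]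
    have h1 := (((hLd 0 (Metric.mem_ball_self hr)).const_mul (n : ℂ)).neg.cexp).mul
      ((hud 1 n 0).sub ((hL2.const_mul (n : ℂ)).mul (hud 0 n 0)))
    have h2 : deriv (fun z => Complex.exp (-(n * L z)) * (u 1 n z - n * deriv L z * u 0 n z)) 0 =
        Complex.exp (-(n * L 0)) * -(n * deriv L 0) * (u 1 n 0 - n * deriv L 0 * u 0 n 0) +
        Complex.exp (-(n * L 0)) * (u 2 n 0 -
          (n * deriv (deriv L) 0 * u 0 n 0 + n * deriv L 0 * u 1 n 0)) := h1.deriv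
    rw [h2, hL'0, hL0, hu1, hu0, hu2]
    simp
  refine ⟨hL'0, ?_⟩
  -- The second-order Cauchy estimate: `E[S_n²] - n L''(0)` stays bounded, so dividing by `n` gives
  -- the limit.
  have hdiff : ∀ n : ℕ, |(∫ x, S n x ^ 2 ∂μ) - n * (deriv (deriv L) 0).re| ≤
      (2 : ℕ).factorial * C / (r / 2) ^ 2 := by
    intro n
    have := Complex.norm_iteratedDeriv_le_of_forall_mem_sphere_norm_le 2 hr2 (hdc n)
      (fun z hz => hbound n z (hsub (Metric.sphere_subset_closedBall hz)))
    rw [hg2] at this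
    refine le_trans (le_of_eq ?_) ((Complex.abs_re_le_norm _).trans this)
    simp
  rw [tendsto_iff_norm_sub_tendsto_zero]
  refine squeeze_zero' (Eventually.of_forall fun n => norm_nonneg _) ?_
    (tendsto_const_div_atTop_nhds_zero_nat ((2 : ℕ).factorial * C / (r / 2) ^ 2))
  filter_upwards [eventually_gt_atTop 0] with n hn
  have hn' : (0 : ℝ) < n := by exact_mod_cast hn
  have e : (∫ x, S n x ^ 2 ∂μ) / n - (deriv (deriv L) 0).re =
      ((∫ x, S n x ^ 2 ∂μ) - n * (deriv (deriv L) 0).re) / n := by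
    field_simp
  rw [e, norm_div, Real.norm_eq_abs, Real.norm_of_nonneg hn'.le]
  exact div_le_div_of_nonneg_right (hdiff n) hn'.le

/-! ### Growth rate of the moment generating functions -/

/-- Exponential growth rate of the moment generating function of the Birkhoff sums, under every
probability measure with density in `B`. -/
theorem tendsto_log_integral_exp_birkhoffSum {X : Type*} [MeasurableSpace X] {m : Measure X}
    [IsProbabilityMeasure m] {T : X → X} {φ : X → ℝ} {K : ℝ}
    {B : Type*} [NormedAddCommGroup B] [NormedSpace ℂ B]
    {ι : B →L[ℂ] Lp ℂ 1 m} {P E : B →L[ℂ] B} {θ : ℝ} (hT : Measure.QuasiMeasurePreserving T m m)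
    (hP : ∀ f : B, ι (P f) = transfer m T (ι f)) (hφ : AEMeasurable φ m)
    (hK : ∀ᵐ x ∂m, |φ x| ≤ K)
    (hE : ∀ f, (ι (E f) : X → ℂ) =ᵐ[m] fun x => Complex.exp (θ * φ x) * (ι f : X → ℂ) x)
    {h₀ : B} (hconv : ∀ f, Tendsto (fun n => (P ^ n) f) atTop (𝓝 (integralFunctional ι f • h₀)))
    {μ : Measure X} [IsProbabilityMeasure μ] (hμ : μ ≪ m)
    (hμ₀ : (ι h₀ : X → ℂ) =ᵐ[m] fun x => (((μ.rnDeriv m x).toReal : ℝ) : ℂ))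
    {lam : ℂ} (hlam : ‖lam - 1‖ < 1 / 2) {C : ℝ}
    (hC : ∀ n f, ‖integralFunctional ι (((P * E) ^ n) f)‖ ≤ C * ‖lam‖ ^ n * ‖f‖) {ℓ : B → ℂ}
    (hℓ : ∀ f, Tendsto (fun n => integralFunctional ι (((P * E) ^ n) f) / lam ^ n) atTop
      (𝓝 (ℓ f))) (hℓ₀ : ‖ℓ h₀ - 1‖ ≤ 1 / 2)
    {ν : Measure X} [IsProbabilityMeasure ν] (hν : ν ≪ m) {g : B}
    (hg : (ι g : X → ℂ) =ᵐ[m] fun x => (((ν.rnDeriv m x).toReal : ℝ) : ℂ)) :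
    Tendsto (fun n : ℕ => 1 / (n : ℝ) * Real.log (∫ x, Real.exp (θ * birkhoffSum T φ n x) ∂ν)) atTop
      (𝓝 (Complex.log lam).re) := by
  have hU : ∀ (ν : Measure X) [IsProbabilityMeasure ν], ν ≪ m → ∀ g : B,
      ((ι g : X → ℂ) =ᵐ[m] fun x => (((ν.rnDeriv m x).toReal : ℝ) : ℂ)) → ∀ n,
      integralFunctional ι (((P * E) ^ n) g) =
        ((∫ x, Real.exp (θ * birkhoffSum T φ n x) ∂ν : ℝ) : ℂ) := by
    intro ν _ hν g hg n
    rw [integral_twisted_pow hT hP hφ hK hE, integral_density_mul hν hg, ← integral_complex_ofReal]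
    push_cast
    rfl
  have hUpos : ∀ (ν : Measure X) [IsProbabilityMeasure ν], ν ≪ m → ∀ n,
      0 < ∫ x, Real.exp (θ * birkhoffSum T φ n x) ∂ν := fun ν _ hν n =>
    integral_exp_pos (integrable_exp_birkhoffSum hT hφ hK hν n θ)
  have hre : 1 / 2 < lam.re := by
    have := (abs_lt.1 ((Complex.abs_re_le_norm _).trans_lt hlam)).1
    simp only [Complex.sub_re, Complex.one_re] at this
    linarith
  have hre₀ : 1 / 2 ≤ (ℓ h₀).re := by
    have := (abs_le.1 ((Complex.abs_re_le_norm _).trans hℓ₀)).1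
    simp only [Complex.sub_re, Complex.one_re] at this
    linarith
  have hlam0 : lam ≠ 0 := by
    rintro rfl
    simp only [Complex.zero_re] at hre
    linarith
  have hℓne : ℓ h₀ ≠ 0 := by
    intro h
    rw [h, Complex.zero_re] at hre₀
    linarith
  -- the eigenvalue is real, as a limit of ratios of moment generating functions
  have hreal : lam = (lam.re : ℂ) := by
    have h1 := hℓ h₀
    simp_rw [hU μ hμ h₀ hμ₀] at h1
    have h2 := (h1.comp (tendsto_add_atTop_nat 1)).div h1 hℓne
    rw [div_self hℓne] at h2
    have h3 : Tendsto (fun n : ℕ => (((∫ x, Real.exp (θ * birkhoffSum T φ (n + 1) x) ∂μ) /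
        (∫ x, Real.exp (θ * birkhoffSum T φ n x) ∂μ) : ℝ) : ℂ)) atTop (𝓝 lam) := by
      have h4 := h2.const_mul lam
      rw [mul_one] at h4
      refine h4.congr fun n => ?_
      have hn : ((∫ x, Real.exp (θ * birkhoffSum T φ n x) ∂μ : ℝ) : ℂ) ≠ 0 :=
        Complex.ofReal_ne_zero.2 (hUpos μ hμ n).ne'
      simp only [Function.comp_apply, Pi.div_apply]
      rw [Complex.ofReal_div, pow_succ]
      field_simp
    have h4 := (Complex.continuous_im.tendsto _).comp h3
    refine Complex.ext (by simp) ?_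
    rw [Complex.ofReal_im]
    refine tendsto_nhds_unique h4 ?_
    simp [Function.comp_def]
  set a := lam.re with ha
  have ha0 : 0 < a := by linarith
  have hloga : (Complex.log lam).re = Real.log a := by
    rw [Complex.log_re, hreal, Complex.norm_real, Real.norm_of_nonneg ha0.le]
  -- Continuity of `ℓ`, given only as a pointwise limit, comes from the bound `hC`, uniform in `n`.
  have hℓlip : ∀ f f', ‖ℓ f - ℓ f'‖ ≤ C * ‖f - f'‖ := by
    intro f f'
    refine le_of_tendsto ((hℓ f).sub (hℓ f')).norm (Eventually.of_forall fun n => ?_)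
    rw [← sub_div, ← map_sub, ← map_sub, norm_div, norm_pow,
      div_le_iff₀ (pow_pos (norm_pos_iff.2 hlam0) n)]
    linarith [hC n (f - f')]
  have hv : Tendsto (fun n => (∫ x, Real.exp (θ * birkhoffSum T φ n x) ∂ν) / a ^ n) atTop
      (𝓝 (ℓ g).re) := by
    refine ((Complex.continuous_re.tendsto _).comp (hℓ g)).congr fun n => ?_
    simp only [Function.comp_apply]
    rw [hU ν hν g hg, hreal, ← Complex.ofReal_pow, ← Complex.ofReal_div, Complex.ofReal_re]
  -- A limit of positive quotients could vanish. But `(P ^ k) g` approaches `h₀`, where `ℓ` has real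
  -- part at least `1/2`, and replacing `g` by `(P ^ k) g` only drops the first `k` steps of the
  -- sum, at the cost of a factor independent of `n`.
  have hpos : 0 < (ℓ g).re := by
    have hPk : Tendsto (fun k => (ℓ ((P ^ k) g)).re) atTop (𝓝 (ℓ h₀).re) := by
      refine (Complex.continuous_re.tendsto _).comp ?_
      rw [tendsto_iff_norm_sub_tendsto_zero]
      have h1 := hconv g
      rw [integralFunctional_density hν hg, one_smul, tendsto_iff_norm_sub_tendsto_zero] at h1
      have h2 := h1.const_mul C
      rw [mul_zero] at h2
      exact squeeze_zero (fun _ => norm_nonneg _) (fun k => hℓlip _ _) h2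
    obtain ⟨k, hk⟩ := (hPk.eventually_const_lt (show (0 : ℝ) < (ℓ h₀).re by linarith)).exists
    have hcmp : Real.exp (-(|θ| * (k * K))) * (ℓ ((P ^ k) g)).re ≤ (ℓ g).re * a ^ k := by
      have hl1 := ((Complex.continuous_re.tendsto _).comp (hℓ ((P ^ k) g))).const_mul
        (Real.exp (-(|θ| * (k * K))))
      have hl2 := (hv.comp (tendsto_add_atTop_nat k)).mul_const (a ^ k)
      refine le_of_tendsto_of_tendsto' hl1 hl2 fun n => ?_
      have := exp_mul_integral_pow_le hT hP hφ hK hν hg θ k n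
      rw [← integral_twisted_pow hT hP hφ hK hE, add_comm k n] at this
      simp only [Function.comp_apply]
      rw [hreal, ← Complex.ofReal_pow, Complex.div_ofReal_re, pow_add, ← mul_div_assoc,
        div_le_iff₀ (by positivity)]
      refine this.trans (le_of_eq ?_)
      field_simp
    have h1 : 0 < (ℓ g).re * a ^ k := lt_of_lt_of_le (mul_pos (Real.exp_pos _) hk) hcmp
    exact pos_of_mul_pos_left h1 (by positivity)
  have hlog := (hv.log hpos.ne')
  have h0 := (tendsto_const_div_atTop_nhds_zero_nat (1 : ℝ)).mul hlog
  have h1 := h0.add_const (Real.log a)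
  rw [zero_mul, zero_add, ← hloga] at h1
  refine h1.congr' ?_
  filter_upwards [eventually_gt_atTop 0] with n hn
  have hn' : (0 : ℝ) < n := by exact_mod_cast hn
  rw [Real.log_div (hUpos ν hν n).ne' (by positivity), Real.log_pow, hloga]
  field_simp
  ring

/-! ### Centred sums, convexity on the real axis, and the main theorem -/

theorem integral_birkhoffSum_eq_zero {X : Type*} [MeasurableSpace X] {μ : Measure X} {T : X → X}
    (hT : MeasurePreserving T μ μ) {φ : X → ℝ} (hφ : Integrable φ μ) (h0 : ∫ x, φ x ∂μ = 0)
    (n : ℕ) : ∫ x, birkhoffSum T φ n x ∂μ = 0 := by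
  have hk : ∀ k, Integrable (fun x => φ (T^[k] x)) μ := fun k =>
    (hT.iterate k).integrable_comp_of_integrable hφ
  simp only [birkhoffSum]
  rw [integral_finsetSum _ fun k _ => hk k]
  refine Finset.sum_eq_zero fun k _ => ?_
  have hmap := (hT.iterate k).map_eq
  have := integral_map (μ := μ) (φ := T^[k]) (hT.iterate k).aemeasurable (f := φ)
    (by rw [hmap]; exact hφ.aestronglyMeasurable)
  rw [← this, hmap, h0]

/-- A function holomorphic near `0`, with vanishing first and positive second derivative there,
is strictly convex along the real axis near `0`. -/
theorem exists_strictMonoOn_re_deriv {L : ℂ → ℂ} {r : ℝ} (hr : 0 < r)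
    (hL : DifferentiableOn ℂ L (Metric.ball 0 r)) (h2 : 0 < (deriv (deriv L) 0).re) :
    ∃ a, 0 < a ∧ a ≤ r ∧
      (∀ θ ∈ Set.Ioo (-a) a, HasDerivAt (fun θ : ℝ => (L θ).re) (deriv L θ).re θ) ∧
      ContinuousOn (fun θ : ℝ => (deriv L θ).re) (Set.Ioo (-a) a) ∧
      StrictMonoOn (fun θ : ℝ => (deriv L θ).re) (Set.Ioo (-a) a) := by
  have hL' := hL.deriv Metric.isOpen_ball
  have hL'' := hL'.deriv Metric.isOpen_ball
  have hball : Metric.ball (0 : ℂ) r ∈ 𝓝 (0 : ℂ) := Metric.ball_mem_nhds _ hr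
  have hc : ContinuousAt (fun θ : ℝ => (deriv (deriv L) θ).re) 0 :=
    Complex.continuous_re.continuousAt.comp
      (ContinuousAt.comp (f := fun θ : ℝ => (θ : ℂ)) (g := deriv (deriv L))
        (by simpa using (hL''.differentiableAt hball).continuousAt)
        Complex.continuous_ofReal.continuousAt)
  obtain ⟨a, ha, haball⟩ := Metric.eventually_nhds_iff_ball.1
    (hc.eventually_const_lt (by simpa using h2))
  have hmem : ∀ θ ∈ Set.Ioo (-(min a r)) (min a r), (θ : ℂ) ∈ Metric.ball (0 : ℂ) r ∧
      θ ∈ Metric.ball (0 : ℝ) a := by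
    intro θ hθ
    have := abs_lt.2 hθ
    rw [mem_ball_zero_iff, mem_ball_zero_iff, Complex.norm_real, Real.norm_eq_abs]
    exact ⟨this.trans_le (min_le_right _ _), this.trans_le (min_le_left _ _)⟩
  have hd1 : ∀ θ ∈ Set.Ioo (-(min a r)) (min a r),
      HasDerivAt (fun θ : ℝ => (deriv L θ).re) (deriv (deriv L) θ).re θ := fun θ hθ =>
    ((hL'.differentiableAt (Metric.isOpen_ball.mem_nhds
      (hmem θ hθ).1)).hasDerivAt).real_of_complex
  have hcont : ContinuousOn (fun θ : ℝ => (deriv L θ).re) (Set.Ioo (-(min a r)) (min a r)) :=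
    fun θ hθ => (hd1 θ hθ).continuousAt.continuousWithinAt
  refine ⟨min a r, lt_min ha hr, min_le_right _ _, fun θ hθ => ?_, hcont, ?_⟩
  · exact ((hL.differentiableAt (Metric.isOpen_ball.mem_nhds
      (hmem θ hθ).1)).hasDerivAt).real_of_complex
  · refine strictMonoOn_of_deriv_pos (convex_Ioo _ _) hcont fun θ hθ => ?_
    rw [interior_Ioo] at hθ
    rw [(hd1 θ hθ).deriv]
    exact haball θ (hmem θ hθ).2

theorem theorem1 {X : Type*} [MeasurableSpace X] (m : Measure X) [IsProbabilityMeasure m]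
    (T : X → X) (hT : Measure.QuasiMeasurePreserving T m m)
    {B : Type*} [NormedAddCommGroup B] [NormedSpace ℂ B] [CompleteSpace B]
    (ι : B →L[ℂ] Lp ℂ 1 m) (hB : IsBanachAlgebraLattice ι)
    -- `P` is the transfer operator as a bounded operator on `B`
    (P : B →L[ℂ] B) (hP : ∀ f : B, ι (P f) = transfer m T (ι f))
    (hrad : spectralRadius ℂ P = 1)
    (hqc : IsQuasiCompactDiagonal P)
    (hsimple : HasSimplePeripheralEigenvalueOne P) :
    (∃! μ : Measure X, IsAcip T ι μ) ∧
    ∀ μ : Measure X, IsAcip T ι μ →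
    ∀ φ : X → ℝ,
      (∃ b : B, (ι b : X → ℂ) =ᵐ[m] fun x => (φ x : ℂ)) →
      (∃ K : ℝ, ∀ᵐ x ∂m, |φ x| ≤ K) →
      ∫ x, φ x ∂μ = 0 →
      ∃ σsq : ℝ,
        Tendsto (fun n : ℕ => ∫ x, (birkhoffSum T φ n x / Real.sqrt n) ^ 2 ∂μ) atTop (𝓝 σsq) ∧
        (0 < σsq →
          ∃ ε₀ : ℝ, 0 < ε₀ ∧ ∃ c : ℝ → ℝ,
            ContinuousOn c (Set.Ioo (-ε₀) ε₀) ∧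
            StrictConvexOn ℝ (Set.Ioo (-ε₀) ε₀) c ∧
            (∀ ε ∈ Set.Ioo (-ε₀) ε₀, 0 ≤ c ε) ∧
            (∀ ε ∈ Set.Ioo (-ε₀) ε₀, c ε = 0 ↔ ε = 0) ∧
            ∀ ε : ℝ, 0 < ε → ε < ε₀ →
              ∀ ν : Measure X, IsProbWithDensityIn ι ν →
                Tendsto
                  (fun n : ℕ => (1 / (n : ℝ)) *
                    Real.log (ν.real {x | (n : ℝ) * ε < birkhoffSum T φ n x}))
                  atTop (𝓝 (-c ε))) := by
  obtain ⟨e, he⟩ := hB.const_mem 1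
  have hmie : integralFunctional ι e = 1 := by
    rw [integralFunctional_apply, integral_congr_ae he]
    simp
  obtain ⟨h₀, Q, hPQ, h1, hQ0, hmQ, hQ⟩ :=
    hqc.exists_rank_one_decomposition hsimple (integralFunctional_transfer hT hP) hmie
  refine ⟨existsUnique_isAcip hB hT hP hPQ h1 hQ0 hmQ hQ, ?_⟩
  rintro μ ⟨⟨hprob, hμm, h₁, hμ₁⟩, hinv⟩ φ ⟨b, hb⟩ ⟨K, hK⟩ hmean
  obtain rfl : h₁ = h₀ := fixed_eq_of_integralFunctional_eq_one hPQ h1 hQ0 hmQ hQ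
    ((measurePreserving_iff_density_fixed hB.injective hT hP hμm hμ₁).1 hinv)
    (integralFunctional_density hμm hμ₁)
  have hφ : AEMeasurable φ m := by
    have h := (L1.integrable_coeFn (ι b)).aestronglyMeasurable.aemeasurable
    refine (Complex.measurable_re.comp_aemeasurable h).congr ?_
    filter_upwards [hb] with x hx
    rw [Function.comp_apply, hx, Complex.ofReal_re]
  obtain ⟨M, hMb⟩ := hB.exists_mulOperator b
  have hM : ∀ f, (ι (M f) : X → ℂ) =ᵐ[m] fun x => (φ x : ℂ) * (ι f : X → ℂ) x := by
    intro f
    filter_upwards [hMb f, hb] with x h1 h2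
    rw [h1, h2]
  have hE := exp_mulOperator_ae_eq hM
  set A : ℂ → B →L[ℂ] B := fun z => P * NormedSpace.exp (z • M) with hA
  have hAsmooth : ContDiff ℂ 1 A := by
    refine contDiff_const.mul ?_
    refine ContDiff.comp (g := fun F : B →L[ℂ] B => NormedSpace.exp F) ?_
      (contDiff_id.smul contDiff_const)
    exact contDiff_iff_contDiffAt.2 fun F => (NormedSpace.exp_analytic (𝕂 := ℂ) F).contDiffAt
  have hA0 : ∀ f, A 0 f = integralFunctional ι f • h₁ + Q f := by
    intro f
    rw [← hPQ]
    simp [hA]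
  obtain ⟨r, lam, C, hr, hlamd, hlam0, hlam⟩ :=
    exists_perturbed_eigenvalue hAsmooth hA0 h1 hQ0 hmQ hQ
  -- Since `lam z` stays within `1/2` of `1`, the principal logarithm is holomorphic along it.
  have hslit : ∀ z ∈ Metric.ball (0 : ℂ) r, lam z ∈ Complex.slitPlane := by
    intro z hz
    have := (abs_lt.1 ((Complex.abs_re_le_norm _).trans_lt (hlam z hz).1)).1
    simp only [Complex.sub_re, Complex.one_re] at this
    exact Or.inl (by linarith)
  set L : ℂ → ℂ := fun z => Complex.log (lam z) with hL
  have hLd : DifferentiableOn ℂ L (Metric.ball 0 r) := hlamd.clog hslit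
  have hL0 : L 0 = 0 := by simp [hL, hlam0]
  have hMGF : ∀ n z, ProbabilityTheory.complexMGF (birkhoffSum T φ n) μ z =
      integralFunctional ι ((A z ^ n) h₁) := by
    intro n z
    rw [hA, integral_twisted_pow hT hP hφ hK (hE z), integral_density_mul hμm hμ₁]
    rfl
  obtain ⟨hL', hvar⟩ := tendsto_second_moment_of_complexMGF_le (μ := μ) (S := birkhoffSum T φ)
    (C := C * ‖h₁‖)
    (fun n => integrableExpSet_eq_univ_of_bounded ((aemeasurable_birkhoffSum hT hφ n).mono_ac hμm)
      (hμm.ae_le (ae_abs_birkhoffSum_le hT hK n)))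
    (integral_birkhoffSum_eq_zero hinv
      (Integrable.of_bound (hφ.mono_ac hμm).aestronglyMeasurable K (hμm.ae_le hK)) hmean)
    hr hLd hL0 (by
      intro n z hz
      rw [hMGF, hL, Complex.exp_log (Complex.slitPlane_ne_zero (hslit z hz))]
      refine ((hlam z hz).2.1 n h₁).trans (le_of_eq ?_)
      ring)
  refine ⟨(deriv (deriv L) 0).re, hvar.congr fun n => ?_, fun hσ => ?_⟩
  · simp_rw [div_pow, Real.sq_sqrt (Nat.cast_nonneg n)]
    rw [integral_div]
  obtain ⟨a, ha, har, hd, hψc, hψm⟩ := exists_strictMonoOn_re_deriv hr hLd hσ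
  have htan := fun t ht θ hθ hne => tangent_lt_of_strictMonoOn hd hψm (t := t) (θ := θ) ht hθ hne
  obtain ⟨ε₀, hε₀, c, hc1, hc2, hc3, hc4, hc5⟩ := exists_rate_function
    (Λ := fun θ : ℝ => (L θ).re) (ψ := fun θ : ℝ => (deriv L θ).re) ha
    (by simp [hL0]) (by simp [hL']) hψc hψm htan
  refine ⟨ε₀, hε₀, c, hc1, hc2, hc3, hc4, ?_⟩
  rintro ε hε hεε₀ ν ⟨hνprob, hνm, g, hg⟩
  -- The level `ε` is the slope of `Re L` at `t`, and `-c ε` the matching Legendre value, which is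
  -- the form the Gärtner-Ellis limit takes.
  obtain ⟨t, ht, rfl, hct⟩ := hc5 ε hε hεε₀
  rw [hct]
  refine tendsto_log_measure_gt (fun n => (aemeasurable_birkhoffSum hT hφ n).mono_ac hνm)
    (fun n θ => integrable_exp_birkhoffSum hT hφ hK hνm n θ) (Λ := fun θ : ℝ => (L θ).re)
    (ψ := fun θ : ℝ => (deriv L θ).re) (a := a) ?_
    (fun θ hθ => (hd θ hθ).continuousAt.continuousWithinAt) hψc htan ht
  intro θ hθ
  have hθr : (θ : ℂ) ∈ Metric.ball (0 : ℂ) r := by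
    rw [mem_ball_zero_iff, Complex.norm_real, Real.norm_eq_abs]
    exact (abs_lt.2 hθ).trans_le har
  obtain ⟨hlam1, hC, ℓ, hℓ, hℓ₀⟩ := hlam θ hθr
  exact tendsto_log_integral_exp_birkhoffSum hT hP hφ hK (hE θ)
    (tendsto_pow_apply hPQ h1 hQ0 hmQ hQ) hμm hμ₁ hlam1 hC hℓ hℓ₀ hνm hg
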